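/- Setting. Let $H=(W,E)$ be a finite simple undirected graph (a network) whose vertices are agents. A state $\theta$ is uniform on $\{0,1\}$. Each agent $v$ has an arrival time $t_v$ uniform on $[0,1]$ and a signal $s_v\in\{0,1\}$ which, conditionally on $\theta$, equals $\theta$ with probability $p$ and $1-\theta$ with probability $1-p$, where $\tfrac12<p\le 1$; the arrival times are independent of each other and of $\theta$ and the signals, and the signals are independent conditionally on $\theta$. Upon arrival, agent $v$ observes $s_v$, the set $F_{v,T}$ of his neighbours $u$ with $t_u<t_v$, and their actions $(a_u)_{u\in F_{v,T}}$ (but not the arrival times), and takes an action $a_v\in\{0,1\}$. A mixed strategy $\sigma_v$ maps the information $(s_v,F_{v,T},(a_u)_{u\in F_{v,T}})$ to a probability distribution on $\{0,1\}$, from which $a_v$ is drawn. A profile $\sigma=(\sigma_v)_{v\in W}$ is an equilibrium if no agent $v$ can increase $l_\sigma(v)=\mathbb P_\sigma(a_v=\theta)$ by changing only $\sigma_v$. It is state-symmetric if the joint law of $\theta$, $(s_v)_v$, $(t_v)_v$, $(a_v)_v$ is invariant under replacing $\theta$, all $s_v$ and all $a_v$ by $1-\theta$, $1-s_v$, $1-a_v$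 simultaneously (arrival times unchanged). The learning quality of $H$ is $L_\sigma(H)=\frac1{|W|}\sum_{v\in W}l_\sigma(v)$. Put $$\psi(d,r,D)=2d\left(\frac{eD}{r}\right)^{r},\qquad \delta(p,d,r,D)=\psi(d,r,D)+\frac{18}{\sqrt{d-1}\,\bigl(2p-1-\psi(d,r,D)\bigr)},$$ with $\left(\frac{eD}{r}\right)^{r}=1$ for $r=0$. Lemma. Let $G=(V,E)$ be a non-empty $D$-regular network with $D\ge 2$ and girth $g$, let $|\lambda_1|\ge|\lambda_2|\ge\dots\ge|\lambda_{|V|}|$ be the eigenvalues of its adjacency matrix with multiplicity, ordered by absolute value, and let $r=\left\lfloor\frac{g-3}{2}\right\rfloor$. Assume $\tfrac12<p\le1$ and $2p-1-\psi(D,r,D)>0$. Then for every $\alpha\in(0,1]$, every $V'\subset V$ with $|V'|=\lceil\alpha|V|\rceil$, and every state-symmetric equilibrium $\sigma'$ of the game on the induced subnetwork $G^{V'}$, $$L_{\sigma'}\bigl(G^{V'}\bigr)\ \ge\ 1-\left(\frac{2}{\sqrt{\alpha}}+\frac{(1-\alpha)\,|\lambda_2|^2}{\alpha^3 D^{3/2}}\right)\cdot\delta(p,D,r,D).$$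 -/

import Mathlib

open MeasureTheory

namespace SocialLearning

/-! ## The learning game on an a-priori network

Agents are the vertices of a finite simple graph `H` on `W`. The set `{0,1}` of states, signals and
actions is `Bool`, with `true` for `1`. -/

section Game

variable {W : Type*}

/-- The information set of an agent: his own signal, the set of earlier friends he observes, and
their actions. The second component maps an observed friend `u` to `some (action of u)` and
everybody else to `none`. -/
abbrev Info (W : Type*) : Type _ := Bool × (W → Option Bool)

/-- A profile of mixed strategies. The distribution on `{0,1}` that agent `v` uses at an information
set is recorded as the probability with which he takes action `1`. -/
abbrev Profile (W : Type*) : Type _ := W → Info W → unitInterval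

/-- The primitive randomness: the state, for each agent whether his signal is correct, the arrival
times, and for each agent a private randomization device used to carry out mixed strategies. -/
abbrev Sample (W : Type*) : Type _ :=
  Bool × (W → Bool) × (W → unitInterval) × (W → unitInterval)

/-- The state `θ`. -/
def state (ω : Sample W) : Bool := ω.1

/-- The signal `s_v`: it is `θ` if the signal is correct and `1 - θ` otherwise. -/
def signal (ω : Sample W) (v : W) : Bool := if ω.2.1 v then state ω else !(state ω)

/-- The arrival time `t_v`. -/
def arrival (ω : Sample W) (v : W) : unitInterval := ω.2.2.1 v

/-- The private randomization device of `v`. -/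
def device (ω : Sample W) (v : W) : unitInterval := ω.2.2.2 v

/-- The law of the primitive randomness: the state is uniform on `{0,1}`, each signal is correct
with probability `p`, arrival times and randomization devices are uniform on `[0,1]`, and everything
is independent. -/
noncomputable def prob (W : Type*) [Fintype W] (p : unitInterval) : Measure (Sample W) :=
  (ProbabilityTheory.bernoulliMeasure true false (⟨1 / 2, by norm_num, by norm_num⟩ : unitInterval)).prod
    ((Measure.pi fun _ : W => ProbabilityTheory.bernoulliMeasure true false p).prod
      ((Measure.pi fun _ : W => (volume : Measure unitInterval)).prod
        (Measure.pi fun _ : W => (volume : Measure unitInterval))))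

open Classical in
/-- The action `a_v` under the profile `σ`, by recursion along the order of arrival: `v` observes his
signal and the actions of those friends who arrived strictly before him, and takes action `1` with
the probability that `σ v` prescribes at this information set. -/
noncomputable def action [Fintype W] (H : SimpleGraph W) (σ : Profile W) (ω : Sample W) (v : W) : Bool :=
  decide (device ω v < σ v (signal ω v,
    fun u => if _h : H.Adj v u ∧ arrival ω u < arrival ω v then some (action H σ ω u) else none))
termination_by (Finset.univ.filter fun u => arrival ω u < arrival ω v).card
decreasing_by
  refine Finset.card_lt_card (Finset.ssubset_iff_of_subset ?_ |>.2 ⟨u, ?_, ?_⟩)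
  · intro z hz
    simp only [Finset.mem_filter, Finset.mem_univ, true_and] at hz ⊢
    exact hz.trans _h.2
  · simpa using _h.2
  · simp

/-- The observable realization of the game: state, signals, arrival times, actions. -/
abbrev Outcome (W : Type*) : Type _ := Bool × (W → Bool) × (W → unitInterval) × (W → Bool)

/-- Simultaneous flipping of the state, of all signals and of all actions. -/
def flip (x : Outcome W) : Outcome W :=
  (!x.1, fun v => !(x.2.1 v), x.2.2.1, fun v => !(x.2.2.2 v))

variable [Fintype W]

/-- The learning quality `l_σ(v)` of an agent: the probability that his action matches the state. It
is also his expected payoff. -/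
noncomputable def agentQuality (H : SimpleGraph W) (p : unitInterval) (σ : Profile W) (v : W) : ℝ :=
  (prob W p).real {ω | action H σ ω v = state ω}

/-- The learning quality `L_σ(H)` of the network: the expected fraction of agents whose action
matches the state. -/
noncomputable def networkQuality (H : SimpleGraph W) (p : unitInterval) (σ : Profile W) : ℝ :=
  1 / (Fintype.card W : ℝ) * ∑ v, agentQuality H p σ v

open Classical in
/-- Equilibrium: no agent can raise the probability of taking the correct action by a unilateral
change of his strategy. -/
def IsEquilibrium (H : SimpleGraph W) (p : unitInterval) (σ : Profile W) : Prop :=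
  ∀ (v : W) (τ : Info W → unitInterval),
    agentQuality H p (Function.update σ v τ) v ≤ agentQuality H p σ v

/-- The outcome as a function of the primitive randomness. -/
noncomputable def outcome (H : SimpleGraph W) (σ : Profile W) (ω : Sample W) : Outcome W :=
  (state ω, signal ω, arrival ω, action H σ ω)

/-- The joint law `ℙ_σ` of state, signals, arrival times and actions. -/
noncomputable def law (H : SimpleGraph W) (p : unitInterval) (σ : Profile W) :
    Measure (Outcome W) :=
  (prob W p).map (outcome H σ)

/-- The law of the outcome is invariant under simultaneous flipping of state, signals, actions. -/
def IsStateSymmetric (H : SimpleGraph W) (p : unitInterval) (σ : Profile W) : Prop :=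
  (law H p σ).map flip = law H p σ

end Game

/-! ## The quantities in the bound -/

/-- `ψ = 2 d (e D / r) ^ r`. -/
noncomputable def psi (d r D : ℕ) : ℝ :=
  2 * (d : ℝ) * (Real.exp 1 * (D : ℝ) / (r : ℝ)) ^ r

/-- `δ(p, d, r, D) = ψ + 18 / (√(d - 1) (2 p - 1 - ψ))`. -/
noncomputable def delta (p : ℝ) (d r D : ℕ) : ℝ :=
  psi d r D + 18 / (Real.sqrt ((d : ℝ) - 1) * (2 * p - 1 - psi d r D))

/-- `|λ₂|`: the absolute values of the eigenvalues of the adjacency matrix, with multiplicity, are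
listed in decreasing order, and the second entry is taken. -/
noncomputable def absSecondEigenvalue {V : Type*} [Fintype V] [DecidableEq V]
    (G : SimpleGraph V) [DecidableRel G.Adj] : ℝ :=
  ((Finset.univ.val.map fun v : V => |(G.isHermitian_adjMatrix ℝ).eigenvalues v|).sort
    (· ≥ ·)).getD 1 0

end SocialLearning

/-! In equilibrium an agent does at least as well as with any other rule based on his information,
so it suffices to exhibit good rules. The rule used here is to follow the strict majority of the
observed friends. It is reliable if, given the state, the friends' actions are nearly independent
and each is biased towards the truth.

Independence: information reaches `u` only along chains of decreasing arrival times. Unless a chain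
of `r` edges starts at `u`, which has probability at most `D ^ r / (r + 1)!`, his action is
determined inside the ball of radius `r` around him, and this ball can be taken to avoid `v` if `v`
does not arrive before `u` (`action_eq_action_edgesWithin`). Large girth makes these balls disjoint
for distinct friends of `v` (`pairwiseDisjoint_avoidingBall`), so Chebyshev's inequality applies to
the sum of the local actions.

Bias: `u` could follow his signal whenever the set of friends he sees has a given property. With
state symmetry this makes him right with probability at least `p` in each state, conditionally on
that set (`le_measureReal_correct`). The majority argument needs the bias on the event that `u`
arrives before a time `t`, which `u` does not observe. However, the fraction of his other friends
already present estimates his arrival time up to the inverse square root of their number. Weighting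
with `cutoffWeight` of this fraction, on the event that `v` has not been seen, and averaging over
the arrival time of `v`, nearly produces the indicator of that event (`le_integral_localScore`).

Hence `v` errs with probability at most the sum of his friends' chain probabilities plus a multiple
of the average of `timeError` over his friends and of the inverse square root of his degree, both
divided by `2 p - 1` (`le_agentQuality`). Friends of low degree are handled by counting edges from
their side (`sum_timeError_div_le`). Agents of low degree are few: the centred indicator of the
retained vertex set is orthogonal to the constants, so the second eigenvalue controls the variance
of the inner degree (`sum_card_neighbors_sub_sq_le`). Finally, the claimed bound is trivial unless
`α * D` is large, and then the estimates fit (`one_sub_le_of_error_le`). -/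

namespace SocialLearning

/-! ## Resampling coordinates of a product measure -/

section Resampling

variable {ι : Type*} [Fintype ι] {X : ι → Type*} [∀ i, MeasurableSpace (X i)]
  (μ : ∀ i, Measure (X i)) [∀ i, IsProbabilityMeasure (μ i)]

open Classical in
/-- Merging two independent copies of a product measure along a set of coordinates gives a third
copy. -/
theorem measurePreserving_merge (S : Set ι) :
    MeasurePreserving (fun x : (∀ i, X i) × (∀ i, X i) => fun i => if i ∈ S then x.1 i else x.2 i)
      ((Measure.pi μ).prod (Measure.pi μ)) (Measure.pi μ) := by
  have hm : Measurable (fun x : (∀ i, X i) × (∀ i, X i) =>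
      fun i => if i ∈ S then x.1 i else x.2 i) := by
    refine measurable_pi_lambda _ fun i => ?_
    by_cases hi : i ∈ S
    · simp only [hi, if_true]; fun_prop
    · simp only [hi, if_false]; fun_prop
  refine ⟨hm, (Measure.pi_eq fun s hs => ?_).symm⟩
  rw [Measure.map_apply hm (MeasurableSet.univ_pi hs)]
  -- Boxes determine a product measure, and the preimage of a box is a product of two boxes with
  -- complementary constraints.
  have : (fun x : (∀ i, X i) × (∀ i, X i) => fun i => if i ∈ S then x.1 i else x.2 i) ⁻¹'
      Set.univ.pi s = (Set.univ.pi fun i => if i ∈ S then s i else Set.univ) ×ˢ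
        (Set.univ.pi fun i => if i ∈ S then Set.univ else s i) := by
    ext x
    simp only [Set.mem_preimage, Set.mem_pi, Set.mem_univ, forall_true_left, Set.mem_prod]
    rw [← forall_and]
    refine forall_congr' fun i => ?_
    by_cases hi : i ∈ S <;> simp [hi]
  rw [this, Measure.prod_prod, Measure.pi_pi, Measure.pi_pi, ← Finset.prod_mul_distrib]
  refine Finset.prod_congr rfl fun i _ => ?_
  by_cases hi : i ∈ S <;> simp [hi]

/-- Functions of disjoint sets of coordinates are uncorrelated. -/
theorem integral_mul_of_dependsOn {S T : Set ι} (hST : Disjoint S T) {f g : (∀ i, X i) → ℝ}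
    (hf : DependsOn f S) (hg : DependsOn g T) (hfm : Measurable f) (hgm : Measurable g) :
    ∫ x, f x * g x ∂Measure.pi μ = (∫ x, f x ∂Measure.pi μ) * ∫ x, g x ∂Measure.pi μ := by
  classical
  have h := measurePreserving_merge μ S
  -- At a merged point `f` sees only the first copy and `g` only the second, so the integral
  -- factors.
  conv_lhs => rw [← h.map_eq]
  rw [integral_map (f := fun x => f x * g x) h.measurable.aemeasurable
    (hfm.mul hgm).aestronglyMeasurable, ← integral_prod_mul]
  refine integral_congr_ae (Filter.Eventually.of_forall fun x => ?_)
  dsimp only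
  congr 1
  · exact hf fun i hi => by simp [hi]
  · exact hg fun i hi => by simp [Set.disjoint_right.1 hST hi]

/-- One coordinate of a product measure can be resampled. -/
theorem integral_pi_update [DecidableEq ι] (j : ι) {f : (∀ i, X i) → ℝ} (hf : Measurable f)
    {C : ℝ} (hC : ∀ x, |f x| ≤ C) :
    ∫ x, f x ∂Measure.pi μ = ∫ y, (∫ x, f (Function.update x j y) ∂Measure.pi μ) ∂μ j := by
  have h := measurePreserving_merge μ {j}
  conv_lhs => rw [← h.map_eq]
  rw [integral_map h.measurable.aemeasurable hf.aestronglyMeasurable, integral_prod]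
  · rw [← (measurePreserving_eval μ j).map_eq, integral_map]
    · refine integral_congr_ae (Filter.Eventually.of_forall fun x => ?_)
      refine integral_congr_ae (Filter.Eventually.of_forall fun y => ?_)
      dsimp only
      congr 1
      ext i
      by_cases hi : i = j
      · subst hi; simp
      · simp [hi]
    · exact (measurable_pi_apply j).aemeasurable
    · refine StronglyMeasurable.aestronglyMeasurable ?_
      refine StronglyMeasurable.integral_prod_right'
        (f := fun (p : X j × ∀ i, X i) => f (Function.update p.2 j p.1)) ?_
      refine (hf.comp ?_).stronglyMeasurable
      refine measurable_pi_lambda _ fun i => ?_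
      by_cases hi : i = j
      · subst hi; simpa using measurable_fst
      · simp only [Function.update_of_ne hi]; fun_prop
  · exact Integrable.of_bound (hf.comp h.measurable).aestronglyMeasurable C
      (Filter.Eventually.of_forall fun x => by simpa using hC _)

end Resampling

/-! ## Configurations: the primitive randomness without the state -/

/-- The randomness of one agent: correctness of the signal, arrival time, device. -/
abbrev Coord : Type := Bool × unitInterval × unitInterval

/-- The law of the randomness of one agent. -/
noncomputable def coordLaw (p : unitInterval) : Measure Coord :=
  (ProbabilityTheory.bernoulliMeasure true false p).prod
    ((volume : Measure unitInterval).prod (volume : Measure unitInterval))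

instance isProbabilityMeasure_coordLaw (p : unitInterval) : IsProbabilityMeasure (coordLaw p) := by
  unfold coordLaw; infer_instance

/-- The joint law of the randomness of all agents. -/
noncomputable def configLaw (W : Type*) [Fintype W] (p : unitInterval) : Measure (W → Coord) :=
  Measure.pi fun _ => coordLaw p

instance isProbabilityMeasure_configLaw (W : Type*) [Fintype W] (p : unitInterval) :
    IsProbabilityMeasure (configLaw W p) := by
  unfold configLaw; infer_instance

instance isProbabilityMeasure_prob (W : Type*) [Fintype W] (p : unitInterval) :
    IsProbabilityMeasure (prob W p) := by
  unfold prob; infer_instance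

/-- The sample with state `θ` and the randomness `c` of the agents. -/
def toSample {W : Type*} (θ : Bool) (c : W → Coord) : Sample W :=
  (θ, fun w => (c w).1, fun w => (c w).2.1, fun w => (c w).2.2)

/-- The arrival time of `v` in a configuration. -/
def time {W : Type*} (c : W → Coord) (v : W) : unitInterval := (c v).2.1

@[simp] theorem state_toSample {W : Type*} (θ : Bool) (c : W → Coord) :
    state (toSample θ c) = θ := rfl

@[simp] theorem arrival_toSample {W : Type*} (θ : Bool) (c : W → Coord) (v : W) :
    arrival (toSample θ c) v = time c v := rfl

theorem measurable_time {W : Type*} (v : W) : Measurable fun c : W → Coord => time c v := by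
  unfold time; fun_prop

theorem measurable_toSample {W : Type*} (θ : Bool) :
    Measurable (toSample θ : (W → Coord) → Sample W) := by
  unfold toSample; fun_prop

theorem integral_coordLaw (p : unitInterval) {g : unitInterval → ℝ} (hg : Measurable g) :
    ∫ x, g x.2.1 ∂coordLaw p = ∫ t, g t := by
  have h : (coordLaw p).map (fun x => x.2.1) = volume := by
    have : (fun x : Coord => x.2.1) = Prod.fst ∘ Prod.snd := rfl
    rw [this, ← Measure.map_map measurable_fst measurable_snd]
    simp [coordLaw]
  rw [← h, integral_map (by fun_prop) hg.aestronglyMeasurable]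

/-- Given the state, the agents' triples (correctness, arrival, device) are i.i.d. From here on the
state is a parameter and independence is that of the coordinates under `configLaw`. -/
theorem measureReal_prob_eq {W : Type*} [Fintype W] (p : unitInterval) {A : Set (Sample W)}
    (hA : MeasurableSet A) :
    (prob W p).real A = 1 / 2 * (configLaw W p).real {c | toSample true c ∈ A} +
      1 / 2 * (configLaw W p).real {c | toSample false c ∈ A} := by
  set ν := ((Measure.pi fun _ : W => ProbabilityTheory.bernoulliMeasure true false p).prod
      ((Measure.pi fun _ : W => (volume : Measure unitInterval)).prod
        (Measure.pi fun _ : W => (volume : Measure unitInterval)))) with hν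
  have key : ∀ θ : Bool, ν.real {x | (θ, x) ∈ A} =
      (configLaw W p).real {c | toSample θ c ∈ A} := by
    intro θ
    have h1 := measurePreserving_arrowProdEquivProdArrow Bool (unitInterval × unitInterval) W
      (fun _ => ProbabilityTheory.bernoulliMeasure true false p)
      (fun _ => (volume : Measure unitInterval).prod volume)
    have h2 := measurePreserving_arrowProdEquivProdArrow unitInterval unitInterval W
      (fun _ => volume) (fun _ => volume)
    have h3 := ((MeasurePreserving.id (Measure.pi fun _ : W =>
      ProbabilityTheory.bernoulliMeasure true false p)).prod h2).comp h1
    have hB : MeasurableSet {x | (θ, x) ∈ A} := measurable_prodMk_left hA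
    exact (h3.measureReal_preimage hB.nullMeasurableSet).symm
  have hp : prob W p = (ProbabilityTheory.bernoulliMeasure true false
    (⟨1 / 2, by norm_num, by norm_num⟩ : unitInterval)).prod ν := rfl
  rw [← key, ← key, hp, measureReal_def, Measure.prod_apply hA,
    ProbabilityTheory.bernoulliMeasure_def, lintegral_add_measure, lintegral_smul_measure,
    lintegral_smul_measure, lintegral_dirac, lintegral_dirac, ENNReal.toReal_add]
  · simp only [ENNReal.smul_def, smul_eq_mul, ENNReal.toReal_mul]
    congr 2
    show (1 : ℝ) - 1 / 2 = 1 / 2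
    norm_num
  · exact ENNReal.mul_ne_top (by simp) (measure_ne_top _ _)
  · exact ENNReal.mul_ne_top (by simp) (measure_ne_top _ _)

section PrimitiveVariables

variable {W : Type*}

theorem measurable_arrival (v : W) : Measurable fun ω : Sample W => arrival ω v := by
  unfold arrival; fun_prop

theorem measurable_device (v : W) : Measurable fun ω : Sample W => device ω v := by
  unfold device; fun_prop

theorem measurable_state : Measurable fun ω : Sample W => state ω := by
  unfold state; fun_prop

theorem measurable_signal (v : W) : Measurable fun ω : Sample W => signal ω v := by
  have h : Measurable fun ω : Sample W => ω.2.1 v := by fun_prop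
  exact Measurable.ite (h (measurableSet_singleton true)) measurable_state
    ((measurable_of_finite Bool.not).comp measurable_state)

end PrimitiveVariables

/-! ### The realized game: information sets and actions -/

section ActionFacts

variable {W : Type*} [Fintype W] (H : SimpleGraph W)

open Classical in
/-- The information set of `v` in the realized game. -/
noncomputable def realizedInfo (σ : Profile W) (ω : Sample W) (v : W) : Info W :=
  (signal ω v,
    fun u => if H.Adj v u ∧ arrival ω u < arrival ω v then some (action H σ ω u) else none)

theorem action_eq (σ : Profile W) (ω : Sample W) (v : W) :
    action H σ ω v = decide (device ω v < σ v (realizedInfo H σ ω v)) := by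
  classical
  rw [action, realizedInfo]
  congr!

theorem arrival_induction (ω : Sample W) {P : W → Prop}
    (h : ∀ v, (∀ u, arrival ω u < arrival ω v → P u) → P v) (v : W) : P v :=
  (Finite.wellFounded_of_trans_of_irrefl
    (InvImage (· < ·) (arrival ω) : W → W → Prop)).induction v h

theorem info_pattern_isSome (σ : Profile W) (ω : Sample W) (v u : W) :
    ((realizedInfo H σ ω v).2 u).isSome ↔ H.Adj v u ∧ arrival ω u < arrival ω v := by
  classical
  simp only [realizedInfo]
  split_ifs with h <;> simp [h]

open Classical in
/-- An agent's strategy does not affect what he observes. -/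
theorem action_update_of_arrival_lt (σ : Profile W) (v : W) (τ : Info W → unitInterval)
    (ω : Sample W) (u : W) (hu : arrival ω u < arrival ω v) :
    action H (Function.update σ v τ) ω u = action H σ ω u := by
  induction u using arrival_induction ω with
  | h u ih =>
    have hne : u ≠ v := by rintro rfl; exact lt_irrefl _ hu
    rw [action_eq, action_eq, Function.update_of_ne hne]
    congr 3
    unfold realizedInfo
    congr 1
    funext w
    split_ifs with h
    · rw [ih w h.2 (h.2.trans hu)]
    · rfl

open Classical in
theorem realizedInfo_update (σ : Profile W) (v : W) (τ : Info W → unitInterval) (ω : Sample W) :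
    realizedInfo H (Function.update σ v τ) ω v = realizedInfo H σ ω v := by
  unfold realizedInfo
  congr 1
  funext w
  split_ifs with h
  · rw [action_update_of_arrival_lt H σ v τ ω w h.2]
  · rfl

/-! ### Measurability -/

open Classical in
/-- The action computed with recursion depth `n`. -/
noncomputable def depthAction (σ : Profile W) : ℕ → Sample W → W → Bool
  | 0, _, _ => false
  | n + 1, ω, v => decide (device ω v < σ v (signal ω v,
      fun u => if H.Adj v u ∧ arrival ω u < arrival ω v then some (depthAction σ n ω u) else none))

-- The depth of the well-founded recursion varies with `ω`, but it never exceeds the number of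
-- earlier arrivals. A depth uniform in `ω` reduces measurability of actions to induction on a
-- natural number.
open Classical in
theorem depthAction_eq_action (σ : Profile W) (ω : Sample W) (n : ℕ) (v : W)
    (hn : (Finset.univ.filter fun u => arrival ω u < arrival ω v).card < n) :
    depthAction H σ n ω v = action H σ ω v := by
  induction n generalizing v with
  | zero => simp at hn
  | succ n ih =>
    rw [action_eq, depthAction, realizedInfo]
    congr! 6 with u h
    refine congrArg some (ih u (lt_of_lt_of_le (Finset.card_lt_card ?_) (Nat.lt_succ_iff.1 hn)))
    refine Finset.ssubset_iff_of_subset ?_ |>.2 ⟨u, ?_, ?_⟩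
    · intro z hz
      simp only [Finset.mem_filter, Finset.mem_univ, true_and] at hz ⊢
      exact hz.trans h.2
    · simpa using h.2
    · simp

open Classical in
theorem measurableSet_info_eq (f : W → Sample W → Bool) (hf : ∀ u, Measurable (f u)) (v : W)
    (i : Info W) :
    MeasurableSet {ω : Sample W | ((signal ω v, fun u => if H.Adj v u ∧ arrival ω u < arrival ω v
      then some (f u ω) else none) : Info W) = i} := by
  have : {ω : Sample W | ((signal ω v, fun u => if H.Adj v u ∧ arrival ω u < arrival ω v
      then some (f u ω) else none) : Info W) = i} = {ω | signal ω v = i.1} ∩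
      ⋂ u, {ω : Sample W | (if H.Adj v u ∧ arrival ω u < arrival ω v
        then some (f u ω) else none) = i.2 u} := by
    ext ω
    simp [Prod.ext_iff, funext_iff]
  rw [this]
  refine (measurable_signal v (measurableSet_singleton i.1)).inter
    (MeasurableSet.iInter fun u => ?_)
  have h1 : MeasurableSet {ω : Sample W | H.Adj v u ∧ arrival ω u < arrival ω v} :=
    (MeasurableSet.const _).inter
      (measurableSet_lt (measurable_arrival u).subtype_val (measurable_arrival v).subtype_val)
  have h2 : {ω : Sample W | (if H.Adj v u ∧ arrival ω u < arrival ω v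
        then some (f u ω) else none) = i.2 u} =
      ({ω | H.Adj v u ∧ arrival ω u < arrival ω v} ∩ {ω | some (f u ω) = i.2 u}) ∪
      ({ω | H.Adj v u ∧ arrival ω u < arrival ω v}ᶜ ∩ {_ω | none = i.2 u}) := by
    ext ω
    by_cases h : H.Adj v u ∧ arrival ω u < arrival ω v <;> simp [h]
  rw [h2]
  refine (h1.inter ?_).union (h1.compl.inter (MeasurableSet.const _))
  have : {ω | some (f u ω) = i.2 u} = f u ⁻¹' {b | some b = i.2 u} := rfl
  rw [this]
  exact hf u (Set.toFinite _).measurableSet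

open Classical in
theorem measurable_decide_device (f : W → Sample W → Bool) (hf : ∀ u, Measurable (f u)) (v : W)
    (τ : Info W → unitInterval) :
    Measurable fun ω : Sample W => decide (device ω v < τ (signal ω v,
      fun u => if H.Adj v u ∧ arrival ω u < arrival ω v then some (f u ω) else none)) := by
  refine measurable_to_bool ?_
  have : (fun ω : Sample W => decide (device ω v < τ (signal ω v,
      fun u => if H.Adj v u ∧ arrival ω u < arrival ω v then some (f u ω) else none))) ⁻¹' {true} =
      ⋃ i : Info W, ({ω : Sample W | ((signal ω v, fun u =>
        if H.Adj v u ∧ arrival ω u < arrival ω v then some (f u ω) else none) : Info W) = i} ∩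
        {ω | device ω v < τ i}) := by
    ext ω
    simp
  rw [this]
  exact MeasurableSet.iUnion fun i => (measurableSet_info_eq H f hf v i).inter
    (measurableSet_lt (measurable_device v) measurable_const)

theorem measurable_depthAction (σ : Profile W) (n : ℕ) (v : W) :
    Measurable fun ω => depthAction H σ n ω v := by
  induction n generalizing v with
  | zero => exact measurable_const
  | succ n ih =>
    simp only [depthAction]
    exact measurable_decide_device H (fun u ω => depthAction H σ n ω u) ih v (σ v)

theorem measurable_action (σ : Profile W) (v : W) : Measurable fun ω => action H σ ω v := by
  classical
  have : (fun ω => action H σ ω v) = fun ω => depthAction H σ (Fintype.card W + 1) ω v := by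
    funext ω
    exact (depthAction_eq_action H σ ω _ v (Nat.lt_succ_iff.2 (Finset.card_le_univ _))).symm
  rw [this]
  exact measurable_depthAction H σ _ v

theorem measurable_decide_realizedInfo (σ : Profile W) (v : W) (τ : Info W → unitInterval) :
    Measurable fun ω => decide (device ω v < τ (realizedInfo H σ ω v)) :=
  measurable_decide_device H (fun u ω => action H σ ω u) (measurable_action H σ) v τ

theorem measurable_outcome (σ : Profile W) : Measurable (outcome H σ) := by
  unfold outcome
  exact measurable_state.prodMk ((measurable_pi_lambda _ measurable_signal).prodMk
    ((measurable_pi_lambda _ measurable_arrival).prodMk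
      (measurable_pi_lambda _ (measurable_action H σ))))

/-! ### Deviations -/

/-- In equilibrium, an agent does at least as well as with any other strategy, applied to the
information he has in equilibrium. -/
theorem IsEquilibrium.le_agentQuality {H : SimpleGraph W} {p : unitInterval} {σ : Profile W}
    (hσ : IsEquilibrium H p σ) (v : W) (τ : Info W → unitInterval) :
    (prob W p).real {ω | decide (device ω v < τ (realizedInfo H σ ω v)) = state ω} ≤
      agentQuality H p σ v := by
  classical
  refine le_trans (le_of_eq ?_) (hσ v τ)
  unfold agentQuality
  congr 1
  ext ω
  rw [Set.mem_ofPred_eq, Set.mem_ofPred_eq, action_eq H (Function.update σ v τ),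
    Function.update_self, realizedInfo_update]

/-! ### Locality -/

/-- Actions depend only on the randomness of agents in a set closed under adjacency. -/
theorem action_congr_of_closed {H : SimpleGraph W} (σ : Profile W) {ω ω' : Sample W} {B : Set W}
    (hB : ∀ a ∈ B, ∀ b, H.Adj a b → b ∈ B) (hθ : state ω = state ω')
    (hs : ∀ a ∈ B, ω.2.1 a = ω'.2.1 a) (ht : ∀ a ∈ B, arrival ω a = arrival ω' a)
    (hd : ∀ a ∈ B, device ω a = device ω' a) (v : W) (hv : v ∈ B) :
    action H σ ω v = action H σ ω' v := by
  classical
  induction v using arrival_induction ω with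
  | h v ih =>
    rw [action_eq, action_eq, hd v hv]
    congr 3
    unfold realizedInfo
    congr 1
    · simp only [signal, hθ, hs v hv]
    · funext w
      by_cases h : H.Adj v w
      · rw [ht v hv, ht w (hB v hv w h)]
        split_ifs with h'
        · rw [ih w (by rw [ht v hv, ht w (hB v hv w h)]; exact h'.2) (hB v hv w h)]
        · rfl
      · simp [h]

/-- There is a chain of `n` edges from `v` along which arrival times decrease. -/
def HasDecreasingChain (t : W → unitInterval) : ℕ → W → Prop
  | 0, _ => True
  | n + 1, v => ∃ u, H.Adj v u ∧ t u < t v ∧ HasDecreasingChain t n u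

/-- The agents that can be reached from `u` by a walk of length at most `r` avoiding `v`. -/
def avoidingBall (v : W) (r : ℕ) (u : W) : Set W :=
  {w | ∃ q : H.Walk u w, q.length ≤ r ∧ v ∉ q.support}

/-- The edges of `H` inside the set `B`. -/
def edgesWithin (B : Set W) : SimpleGraph W where
  Adj a b := H.Adj a b ∧ a ∈ B ∧ b ∈ B
  symm := ⟨fun _ _ h => ⟨h.1.symm, h.2.2, h.2.1⟩⟩
  loopless := ⟨fun _ h => H.loopless.irrefl _ h.1⟩

/-- Everything that influences `u` lies on a chain of decreasing arrival times from `u`. Such a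
chain has fewer than `r` edges, and it misses `v` because `v` is not earlier than `u`; so it stays
in the ball. -/
theorem action_eq_action_edgesWithin (σ : Profile W) (ω : Sample W) (v u : W) (r : ℕ) (huv : u ≠ v)
    (htv : ¬ arrival ω v < arrival ω u) (hch : ¬ HasDecreasingChain H (arrival ω) r u) :
    action H σ ω u = action (edgesWithin H (avoidingBall H v r u)) σ ω u := by
  classical
  -- `q` is the part of the chain already traversed and `n` the number of edges left; at `n = 0` the
  -- missing chain would be the trivial one.
  have key : ∀ (n : ℕ) (w : W) (q : H.Walk u w), q.length + n ≤ r → v ∉ q.support →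
      arrival ω w ≤ arrival ω u → ¬ HasDecreasingChain H (arrival ω) n w →
      action H σ ω w = action (edgesWithin H (avoidingBall H v r u)) σ ω w := by
    intro n
    induction n with
    | zero => intro w q _ _ _ h; exact absurd trivial h
    | succ n ih =>
      intro w q hq hvq hw h
      rw [action_eq, action_eq]
      congr 3
      unfold realizedInfo
      congr 1
      funext x
      by_cases hx : H.Adj w x ∧ arrival ω x < arrival ω w
      · have hvx : v ≠ x := by
          rintro rfl
          exact htv (hx.2.trans_le hw)
        have hsupp : v ∉ (q.concat hx.1).support := by
          rw [SimpleGraph.Walk.support_concat]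
          simp [hvq, hvx]
        have hlen : (q.concat hx.1).length = q.length + 1 := SimpleGraph.Walk.length_concat _ _
        have hadj : (edgesWithin H (avoidingBall H v r u)).Adj w x :=
          ⟨hx.1, ⟨q, by omega, hvq⟩, ⟨q.concat hx.1, by omega, hsupp⟩⟩
        rw [if_pos hx, if_pos ⟨hadj, hx.2⟩,
          ih x (q.concat hx.1) (by omega) hsupp (hx.2.le.trans hw)
            fun hc => h ⟨x, hx.1, hx.2, hc⟩]
      · rw [if_neg hx, if_neg fun hx' => hx ⟨hx'.1.1, hx'.2⟩]
  exact key r u SimpleGraph.Walk.nil (by simp) (by simpa using huv.symm) le_rfl hch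

/-- `edgesWithin` deletes edges but keeps all vertices, so the same profile can be played, and `B`
is closed under the remaining adjacency. -/
theorem dependsOn_action_edgesWithin (σ : Profile W) (θ : Bool) (B : Set W) (u : W) (hu : u ∈ B) :
    DependsOn (fun c : W → Coord => action (edgesWithin H B) σ (toSample θ c) u) B := by
  intro c c' h
  change action _ σ (toSample θ c) u = action _ σ (toSample θ c') u
  refine action_congr_of_closed σ (B := B) (ω := toSample θ c) (ω' := toSample θ c')
    (fun a _ b (hab : (edgesWithin H B).Adj a b) => hab.2.2) rfl ?_ ?_ ?_ u hu
  · intro a ha; simp [toSample, h a ha]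
  · intro a ha; simp [time, h a ha]
  · intro a ha; simp [toSample, device, h a ha]

end ActionFacts

/-! ### Probability of long chains of decreasing arrival times -/

section DecreasingChains

variable {W : Type*} [Fintype W]

theorem measurePreserving_comp_perm (p : unitInterval) (e : Equiv.Perm W) :
    MeasurePreserving (fun c : W → Coord => c ∘ e) (configLaw W p) (configLaw W p) := by
  have hm : Measurable (fun c : W → Coord => c ∘ e) :=
    measurable_pi_lambda _ fun i => measurable_pi_apply (e i)
  refine ⟨hm, (Measure.pi_eq fun s hs => ?_).symm⟩
  rw [Measure.map_apply hm (MeasurableSet.univ_pi hs)]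
  have : (fun c : W → Coord => c ∘ e) ⁻¹' Set.univ.pi s = Set.univ.pi fun i => s (e.symm i) := by
    ext c
    simp only [Set.mem_preimage, Set.mem_pi, Set.mem_univ, forall_true_left, Function.comp]
    exact ⟨fun h i => by simpa using h (e.symm i), fun h i => by simpa using h (e i)⟩
  rw [this, configLaw, Measure.pi_pi]
  exact Equiv.prod_comp e.symm fun i => coordLaw p (s i)

theorem measurableSet_strictAnti_time {W : Type*} {m : ℕ} (f : Fin m → W) :
    MeasurableSet {c : W → Coord | StrictAnti fun i => time c (f i)} := by
  have : {c : W → Coord | StrictAnti fun i => time c (f i)} =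
      ⋂ i : Fin m, ⋂ j : Fin m, {c | i < j → time c (f j) < time c (f i)} := by
    ext c
    simp [StrictAnti]
  rw [this]
  refine MeasurableSet.iInter fun i => MeasurableSet.iInter fun j => ?_
  by_cases h : i < j
  · simp only [h, forall_true_left]
    exact measurableSet_lt (measurable_time _) (measurable_time _)
  · simp [h]

/-- The probability that given agents arrive in a given order. -/
theorem measureReal_strictAnti_time_le (p : unitInterval) {m : ℕ} (f : Fin m → W)
    (hf : Function.Injective f) :
    (configLaw W p).real {c | StrictAnti fun i => time c (f i)} ≤ 1 / (m.factorial : ℝ) := by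
  classical
  -- The `m!` possible orders give disjoint events, equally likely by exchangeability.
  set E : Equiv.Perm (Fin m) → Set (W → Coord) :=
    fun π => {c | StrictAnti fun i => time c (f (π i))} with hE
  have hEm : ∀ π, MeasurableSet (E π) := fun π => measurableSet_strictAnti_time (f ∘ π)
  have hEq : ∀ π, (configLaw W p).real (E π) =
      (configLaw W p).real {c | StrictAnti fun i => time c (f i)} := by
    intro π
    -- The permutation of indices is extended to all agents, by the identity outside the range of
    -- `f`.
    rw [← (measurePreserving_comp_perm p (π.viaEmbedding ⟨f, hf⟩)).measureReal_preimage
      (measurableSet_strictAnti_time f).nullMeasurableSet]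
    congr 1
    ext c
    have : ∀ i, π.viaEmbedding ⟨f, hf⟩ (f i) = f (π i) :=
      fun i => Equiv.Perm.viaEmbedding_apply π ⟨f, hf⟩ i
    simp [hE, time, Function.comp, this]
  have hdisj : (↑(Finset.univ : Finset (Equiv.Perm (Fin m))) : Set _).PairwiseDisjoint E := by
    intro π _ π' _ hne
    refine Set.disjoint_left.2 fun c hc hc' => hne ?_
    have h1 : StrictAnti fun i => time c (f (π i)) := hc
    have h2 : StrictAnti fun i => time c (f (π' i)) := hc'
    -- Both orders enumerate the same set of times, and a strictly decreasing enumeration is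
    -- determined by its range.
    have h3 := (h1.range_inj h2).1 ((π.surjective.range_comp fun i => time c (f i)).trans
      (π'.surjective.range_comp fun i => time c (f i)).symm)
    refine Equiv.ext fun i => ?_
    have h6 : time c (f (π i)) = time c (f (π (π.symm (π' i)))) := by
      rw [Equiv.apply_symm_apply]
      exact congrFun h3 i
    exact (congrArg π (h1.injective h6)).trans (Equiv.apply_symm_apply π _)
  have hsum := measureReal_biUnion_finset (μ := configLaw W p) hdisj fun π _ => hEm π
  simp only [hEq, Finset.sum_const, Finset.card_univ, Fintype.card_perm, Fintype.card_fin,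
    nsmul_eq_mul] at hsum
  rw [le_div_iff₀ (by positivity), mul_comm, ← hsum]
  exact measureReal_le_one

variable (H : SimpleGraph W)

open Classical in
/-- The vertex lists of walks with `n` edges from `v`. -/
noncomputable def walkLists : ℕ → W → Finset (List W)
  | 0, v => {[v]}
  | n + 1, v => (H.neighborFinset v).biUnion fun u => (walkLists n u).image (v :: ·)

open Classical in
theorem card_walkLists_le {D : ℕ} (hD : ∀ v, (H.neighborFinset v).card ≤ D) (n : ℕ) (v : W) :
    (walkLists H n v).card ≤ D ^ n := by
  induction n generalizing v with
  | zero => simp [walkLists]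
  | succ n ih =>
    rw [walkLists, pow_succ']
    refine Finset.card_biUnion_le.trans ((Finset.sum_le_card_nsmul _ _ (D ^ n) fun u _ =>
      Finset.card_image_le.trans (ih u)).trans ?_)
    rw [smul_eq_mul]
    exact Nat.mul_le_mul_right _ (hD v)

theorem length_of_mem_walkLists {n : ℕ} {v : W} {l : List W} (h : l ∈ walkLists H n v) :
    l.length = n + 1 := by
  classical
  induction n generalizing v l with
  | zero => simp only [walkLists, Finset.mem_singleton] at h; simp [h]
  | succ n ih =>
    simp only [walkLists, Finset.mem_biUnion, Finset.mem_image] at h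
    obtain ⟨u, _, l', hl', rfl⟩ := h
    simp [ih hl']

theorem HasDecreasingChain.exists_mem_walkLists {t : W → unitInterval} {n : ℕ} {v : W}
    (h : HasDecreasingChain H t n v) :
    ∃ l, v :: l ∈ walkLists H n v ∧ (v :: l).Pairwise fun a b => t b < t a := by
  classical
  induction n generalizing v with
  | zero => exact ⟨[], by simp [walkLists], by simp⟩
  | succ n ih =>
    obtain ⟨u, hvu, htu, hu⟩ := h
    obtain ⟨l, hl, hp⟩ := ih hu
    refine ⟨u :: l, ?_, List.pairwise_cons.2 ⟨?_, hp⟩⟩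
    · simp only [walkLists, Finset.mem_biUnion, Finset.mem_image]
      exact ⟨u, by simpa using hvu, u :: l, hl, rfl⟩
    · intro x hx
      rcases List.mem_cons.1 hx with rfl | hx
      · exact htu
      · exact ((List.pairwise_cons.1 hp).1 x hx).trans htu

theorem measureReal_pairwise_time_le (p : unitInterval) (l : List W) :
    (configLaw W p).real {c | l.Pairwise fun a b => time c b < time c a} ≤
      1 / (l.length.factorial : ℝ) := by
  -- In a list with a repetition some agent would have to arrive strictly before himself.
  by_cases hl : l.Nodup
  · refine le_trans (le_of_eq ?_)
      (measureReal_strictAnti_time_le p l.get (List.nodup_iff_injective_get.1 hl))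
    congr 1
    ext c
    exact List.pairwise_iff_get
  · have : {c : W → Coord | l.Pairwise fun a b => time c b < time c a} = ∅ := by
      ext c
      simp only [Set.mem_ofPred_eq, Set.mem_empty_iff_false, iff_false]
      intro h
      refine hl (h.imp ?_)
      rintro a b hab rfl
      exact lt_irrefl _ hab
    rw [this]
    simp

open Classical in
/-- Long chains with decreasing arrival times are unlikely. -/
theorem measureReal_hasDecreasingChain_le (p : unitInterval) {D : ℕ}
    (hD : ∀ v, (H.neighborFinset v).card ≤ D) (n : ℕ) (v : W) :
    (configLaw W p).real {c | HasDecreasingChain H (time c) n v} ≤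
      (D : ℝ) ^ n / ((n + 1).factorial : ℝ) := by
  have hsub : {c : W → Coord | HasDecreasingChain H (time c) n v} ⊆
      ⋃ l ∈ walkLists H n v, {c | l.Pairwise fun a b => time c b < time c a} := by
    intro c hc
    obtain ⟨l, hl, hp⟩ := HasDecreasingChain.exists_mem_walkLists H hc
    exact Set.mem_biUnion hl hp
  -- Union bound over at most `D ^ n` walks; a walk with `n` edges has `n + 1` vertices, hence the
  -- factorial of `n + 1`.
  refine (measureReal_mono hsub (measure_ne_top _ _)).trans ((measureReal_biUnion_finset_le _ _).trans ?_)
  refine (Finset.sum_le_card_nsmul _ _ (1 / ((n + 1).factorial : ℝ)) fun l hl => ?_).trans ?_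
  · rw [← length_of_mem_walkLists H hl]
    exact measureReal_pairwise_time_le p l
  · rw [nsmul_eq_mul, mul_one_div]
    gcongr
    exact_mod_cast card_walkLists_le H hD n v

end DecreasingChains

/-! ### Equilibrium agents are at least as accurate as their signals -/

section Advantage

variable {W : Type*}

/-- The friends of `u` who arrive before him. -/
def earlier (H : SimpleGraph W) (t : W → unitInterval) (u : W) : Set W :=
  {w | H.Adj u w ∧ t w < t u}

variable [Fintype W] (H : SimpleGraph W)

theorem measurableSet_earlier (u : W) (Q : Set W → Prop) :
    MeasurableSet {t : W → unitInterval | Q (earlier H t u)} := by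
  have : {t : W → unitInterval | Q (earlier H t u)} =
      ⋃ A : Set W, ({_t | Q A} ∩ ⋂ w, {t | (H.Adj u w ∧ t w < t u) ↔ w ∈ A}) := by
    ext t
    simp only [Set.mem_ofPred_eq, Set.mem_iUnion, Set.mem_inter_iff, Set.mem_iInter]
    constructor
    · exact fun h => ⟨_, h, fun w => Iff.rfl⟩
    · rintro ⟨A, hA, h⟩
      rwa [show earlier H t u = A from Set.ext h]
  rw [this]
  refine MeasurableSet.iUnion fun A => (MeasurableSet.const _).inter
    (MeasurableSet.iInter fun w => ?_)
  have h1 : MeasurableSet {t : W → unitInterval | H.Adj u w ∧ t w < t u} :=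
    (MeasurableSet.const _).inter
      (measurableSet_lt (measurable_pi_apply w).subtype_val (measurable_pi_apply u).subtype_val)
  by_cases hw : w ∈ A
  · simpa [hw] using h1
  · simp only [hw, iff_false]
    exact h1.compl

theorem measurableSet_earlier_time (u : W) (Q : Set W → Prop) :
    MeasurableSet {c : W → Coord | Q (earlier H (time c) u)} :=
  (measurable_pi_lambda _ measurable_time : Measurable (time : (W → Coord) → W → unitInterval))
    (measurableSet_earlier H u Q)

theorem measurableSet_earlier_arrival (u : W) (Q : Set W → Prop) :
    MeasurableSet {ω : Sample W | Q (earlier H (arrival ω) u)} :=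
  (measurable_pi_lambda _ measurable_arrival : Measurable (arrival : Sample W → W → unitInterval))
    (measurableSet_earlier H u Q)

/-- A correct signal is independent of the arrival times. -/
theorem measureReal_signal_inter_time (p : unitInterval) (u : W) {T : Set (W → unitInterval)}
    (hT : MeasurableSet T) :
    (configLaw W p).real {c | time c ∈ T ∧ (c u).1 = true ∧ (c u).2.2 ≠ 1} =
      p * (configLaw W p).real {c | time c ∈ T} := by
  have h1 := measurePreserving_arrowProdEquivProdArrow Bool (unitInterval × unitInterval) W
      (fun _ => ProbabilityTheory.bernoulliMeasure true false p)
      (fun _ => (volume : Measure unitInterval).prod volume)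
  set ν : Measure (W → unitInterval × unitInterval) :=
    Measure.pi fun _ => (volume : Measure unitInterval).prod volume with hν
  have hA : MeasurableSet {g : W → Bool | g u = true} :=
    measurableSet_eq_fun (measurable_pi_apply u) measurable_const
  have hB : MeasurableSet {x : W → unitInterval × unitInterval | (fun w => (x w).1) ∈ T} :=
    (measurable_pi_lambda _ fun w => measurable_fst.comp (measurable_pi_apply w) :
      Measurable fun (x : W → unitInterval × unitInterval) w => (x w).1) hT
  have hC : MeasurableSet {x : W → unitInterval × unitInterval | (x u).2 ≠ 1} :=
    ((measurable_snd.comp (measurable_pi_apply u) :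
      Measurable fun (x : W → unitInterval × unitInterval) => (x u).2)
        (measurableSet_singleton 1)).compl
  -- Since `device < σ` is strict, action `1` prescribed with probability one fails exactly at the
  -- device value `1`; this is a null event.
  have hnull : ν {x : W → unitInterval × unitInterval | (x u).2 = 1} = 0 := by
    have h2 := measurePreserving_eval
      (fun _ : W => (volume : Measure unitInterval).prod (volume : Measure unitInterval)) u
    have h3 := h2.measure_preimage
      (s := Set.univ ×ˢ {1}) (MeasurableSet.univ.prod (measurableSet_singleton 1)).nullMeasurableSet
    rw [Measure.prod_prod] at h3
    simp only [measure_singleton, mul_zero] at h3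
    convert h3 using 2
    ext x
    simp
  have e1 : (configLaw W p).real {c | time c ∈ T ∧ (c u).1 = true ∧ (c u).2.2 ≠ 1} =
      ((Measure.pi fun _ : W => ProbabilityTheory.bernoulliMeasure true false p).prod ν).real
        ({g | g u = true} ×ˢ ({x | (fun w => (x w).1) ∈ T} ∩ {x | (x u).2 ≠ 1})) := by
    rw [← h1.measureReal_preimage (hA.prod (hB.inter hC)).nullMeasurableSet]
    unfold configLaw coordLaw
    congr 1
    ext c
    constructor
    · rintro ⟨h1, h2, h3⟩; exact ⟨h2, h1, h3⟩
    · rintro ⟨h1, h2, h3⟩; exact ⟨h2, h1, h3⟩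
  have e2 : (configLaw W p).real {c | time c ∈ T} =
      ((Measure.pi fun _ : W => ProbabilityTheory.bernoulliMeasure true false p).prod ν).real
        (Set.univ ×ˢ {x | (fun w => (x w).1) ∈ T}) := by
    rw [← h1.measureReal_preimage (MeasurableSet.univ.prod hB).nullMeasurableSet]
    unfold configLaw coordLaw
    congr 1
    ext c
    constructor
    · intro h; exact ⟨trivial, h⟩
    · rintro ⟨_, h⟩; exact h
  have e3 : (Measure.pi fun _ : W => ProbabilityTheory.bernoulliMeasure true false p).real
      {g : W → Bool | g u = true} = p := by
    have h2 := measurePreserving_eval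
      (fun _ : W => ProbabilityTheory.bernoulliMeasure true false p) u
    have h3 := h2.measureReal_preimage (s := {true}) (measurableSet_singleton _).nullMeasurableSet
    have h4 : (ProbabilityTheory.bernoulliMeasure true false p).real {true} = p := by
      classical
      rw [ProbabilityTheory.bernoulliMeasure_real_apply _ (measurableSet_singleton _)]
      simp
    rw [← h4, ← h3]
    congr 1
  rw [e1, e2, measureReal_prod_prod, measureReal_prod_prod, e3, probReal_univ, one_mul]
  congr 1
  refine measureReal_congr (Filter.eventuallyEq_set.2 ?_)
  filter_upwards [measure_eq_zero_iff_ae_notMem.1 hnull] with x hx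
  exact and_iff_left hx

theorem measurable_action_toSample (σ : Profile W) (θ : Bool) (u : W) :
    Measurable fun c : W → Coord => action H σ (toSample θ c) u :=
  (measurable_action H σ u).comp (measurable_toSample θ)

variable {H}

/-- The deviation follows the signal if the observed set satisfies `Q` and keeps `σ u` otherwise. It
does not know the state, so only the sum over both states is controlled. -/
theorem IsEquilibrium.le_sum_measureReal {p : unitInterval} {σ : Profile W}
    (hσ : IsEquilibrium H p σ) (u : W) (Q : Set W → Prop) :
    2 * ((p : ℝ) * (configLaw W p).real {c | Q (earlier H (time c) u)}) ≤
      (configLaw W p).real {c | Q (earlier H (time c) u) ∧ action H σ (toSample true c) u = true} +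
      (configLaw W p).real
        {c | Q (earlier H (time c) u) ∧ action H σ (toSample false c) u = false} := by
  classical
  set τ : Info W → unitInterval := fun i =>
    if Q {w | (i.2 w).isSome} then (if i.1 then 1 else 0) else σ u i with hτ
  have hQ : ∀ ω : Sample W, {w | ((realizedInfo H σ ω u).2 w).isSome} =
      earlier H (arrival ω) u := by
    intro ω; ext w; exact info_pattern_isSome H σ ω u w
  have hdev := hσ.le_agentQuality u τ
  set A : Set (Sample W) := {ω | action H σ ω u = state ω} with hA
  set B : Set (Sample W) := {ω | Q (earlier H (arrival ω) u)} with hB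
  set S : Set (Sample W) := {ω | ω.2.1 u = true ∧ device ω u ≠ 1} with hS
  have hAm : MeasurableSet A := measurableSet_eq_fun (measurable_action H σ u) measurable_state
  have hBm : MeasurableSet B := measurableSet_earlier_arrival H u Q
  have hSm : MeasurableSet S :=
    ((by fun_prop : Measurable fun ω : Sample W => ω.2.1 u) (measurableSet_singleton true)).inter
      ((measurable_device u) (measurableSet_singleton 1)).compl
  have hsub : (B ∩ S) ∪ (A \ B) ⊆
      {ω | decide (device ω u < τ (realizedInfo H σ ω u)) = state ω} := by
    rintro ω (⟨hb, hs, hd⟩ | ⟨ha, hb⟩)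
    · have hb' : Q {w | ((realizedInfo H σ ω u).2 w).isSome} := by rw [hQ]; exact hb
      have hsig : (realizedInfo H σ ω u).1 = state ω := by
        simp [realizedInfo, signal, hs]
      simp only [Set.mem_ofPred_eq, hτ, if_pos hb', hsig]
      cases hst : state ω
      · simp
      · simpa using lt_of_le_of_ne unitInterval.le_one' hd
    · have hb' : ¬ Q {w | ((realizedInfo H σ ω u).2 w).isSome} := by rw [hQ]; exact hb
      simp only [Set.mem_ofPred_eq, hτ, if_neg hb']
      rw [← action_eq]
      exact ha
  have h1 := measureReal_mono (μ := prob W p) hsub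
  have hdisj : Disjoint (B ∩ S) (A \ B) :=
    Set.disjoint_left.2 fun ω h h' => h'.2 h.1
  rw [measureReal_union hdisj (hAm.diff hBm)] at h1
  have h2 : agentQuality H p σ u = (prob W p).real (A ∩ B) + (prob W p).real (A \ B) :=
    (measureReal_inter_add_sdiff hBm).symm
  -- Off `B` the deviation changes nothing, so that part cancels.
  have h3 : (prob W p).real (B ∩ S) ≤ (prob W p).real (A ∩ B) := by linarith
  rw [measureReal_prob_eq p (hBm.inter hSm), measureReal_prob_eq p (hAm.inter hBm)] at h3
  have h4 : ∀ θ, (configLaw W p).real {c | toSample θ c ∈ B ∩ S} =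
      p * (configLaw W p).real {c | Q (earlier H (time c) u)} := fun θ =>
    measureReal_signal_inter_time p u (measurableSet_earlier H u Q)
  have h5 : ∀ θ, {c : W → Coord | toSample θ c ∈ A ∩ B} =
      {c | Q (earlier H (time c) u) ∧ action H σ (toSample θ c) u = θ} := by
    intro θ; ext c; exact and_comm
  rw [h4, h4, h5, h5] at h3
  linarith

/-- The flip exchanges "state and action are `1`" with "state and action are `0`" and fixes arrival
times. This splits the bound of `IsEquilibrium.le_sum_measureReal` equally between the states. -/
theorem IsStateSymmetric.measureReal_eq {p : unitInterval} {σ : Profile W}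
    (hσ : IsStateSymmetric H p σ) (u : W) {T : Set (W → unitInterval)} (hT : MeasurableSet T) :
    (configLaw W p).real {c | time c ∈ T ∧ action H σ (toSample true c) u = true} =
      (configLaw W p).real {c | time c ∈ T ∧ action H σ (toSample false c) u = false} := by
  have hflip : Measurable (flip : Outcome W → Outcome W) := by
    have hnot : Measurable Bool.not := measurable_of_finite _
    unfold flip
    exact (hnot.comp measurable_fst).prodMk
      ((measurable_pi_lambda _ fun v => hnot.comp (by fun_prop)).prodMk
        ((by fun_prop : Measurable fun x : Outcome W => x.2.2.1).prodMk
          (measurable_pi_lambda _ fun v => hnot.comp (by fun_prop))))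
  set A : Set (Outcome W) := {x | x.1 = true ∧ x.2.2.1 ∈ T ∧ x.2.2.2 u = true} with hA
  have hAm : MeasurableSet A :=
    (measurable_fst (measurableSet_singleton true)).inter
      (((by fun_prop : Measurable fun x : Outcome W => x.2.2.1) hT).inter
        ((by fun_prop : Measurable fun x : Outcome W => x.2.2.2 u) (measurableSet_singleton true)))
  have hout := measurable_outcome H σ
  have h1 : (prob W p).real (outcome H σ ⁻¹' A) = (prob W p).real (outcome H σ ⁻¹' (flip ⁻¹' A)) := by
    have := congrArg (fun m => m.real A) hσ
    simp only [law, measureReal_def] at this ⊢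
    rw [Measure.map_apply hflip hAm, Measure.map_apply hout (hflip hAm),
      Measure.map_apply hout hAm] at this
    exact this.symm
  rw [measureReal_prob_eq p (hout hAm), measureReal_prob_eq p (hout (hflip hAm))] at h1
  have e1 : {c : W → Coord | toSample true c ∈ outcome H σ ⁻¹' A} =
      {c | time c ∈ T ∧ action H σ (toSample true c) u = true} := by
    ext c
    exact ⟨fun h => h.2, fun h => ⟨rfl, h⟩⟩
  have e2 : {c : W → Coord | toSample false c ∈ outcome H σ ⁻¹' A} = ∅ := by
    ext c
    simp [hA, outcome]
  have e3 : {c : W → Coord | toSample true c ∈ outcome H σ ⁻¹' (flip ⁻¹' A)} = ∅ := by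
    ext c
    simp [hA, outcome, flip]
  have e4 : {c : W → Coord | toSample false c ∈ outcome H σ ⁻¹' (flip ⁻¹' A)} =
      {c | time c ∈ T ∧ action H σ (toSample false c) u = false} := by
    ext c
    refine ⟨fun h => ⟨h.2.1, ?_⟩, fun h => ⟨rfl, h.1, ?_⟩⟩
    · simpa [outcome, flip] using h.2.2
    · simpa [outcome, flip] using h.2
  rw [e1, e2, e3, e4] at h1
  simp only [measureReal_empty] at h1
  linarith

/-- In a state-symmetric equilibrium an agent is at least as accurate as his signal, in each state
and conditionally on any event determined by the set of friends he observes. -/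
theorem le_measureReal_correct {p : unitInterval} {σ : Profile W}
    (hσ : IsEquilibrium H p σ) (hs : IsStateSymmetric H p σ) (θ : Bool) (u : W)
    (Q : Set W → Prop) :
    (p : ℝ) * (configLaw W p).real {c | Q (earlier H (time c) u)} ≤
      (configLaw W p).real {c | Q (earlier H (time c) u) ∧ action H σ (toSample θ c) u = θ} := by
  have h1 := hσ.le_sum_measureReal u Q
  have h2 := hs.measureReal_eq u (measurableSet_earlier H u Q)
  simp only [Set.mem_ofPred_eq] at h2
  cases θ <;> linarith

end Advantage

/-! ### Variance of sums with disjoint dependence -/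

section Uncorrelated

variable {W : Type*} [Fintype W] (p : unitInterval)

/-- The variance of a sum of bounded functions of disjoint sets of agents. -/
theorem integral_sum_sub_sq {κ : Type*} (A : Finset κ) (f : κ → (W → Coord) → ℝ) (B : κ → Set W)
    (hB : (A : Set κ).PairwiseDisjoint B) (hf : ∀ i ∈ A, DependsOn (f i) (B i))
    (hm : ∀ i ∈ A, Measurable (f i)) (hb : ∀ i ∈ A, ∀ c, |f i c| ≤ 1) :
    ∫ c, (∑ i ∈ A, (f i c - ∫ x, f i x ∂configLaw W p)) ^ 2 ∂configLaw W p =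
      ∑ i ∈ A, (∫ c, f i c ^ 2 ∂configLaw W p - (∫ c, f i c ∂configLaw W p) ^ 2) := by
  set m : κ → ℝ := fun i => ∫ x, f i x ∂configLaw W p with hmdef
  have hint : ∀ i ∈ A, Integrable (f i) (configLaw W p) := fun i hi =>
    Integrable.of_bound (hm i hi).aestronglyMeasurable 1
      (Filter.Eventually.of_forall fun c => hb i hi c)
  have hint2 : ∀ i ∈ A, ∀ j ∈ A, Integrable (fun c => f i c * f j c) (configLaw W p) :=
    fun i hi j hj => Integrable.of_bound ((hm i hi).mul (hm j hj)).aestronglyMeasurable 1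
      (Filter.Eventually.of_forall fun c => by
        rw [Real.norm_eq_abs, abs_mul]
        exact mul_le_one₀ (hb i hi c) (abs_nonneg _) (hb j hj c))
  have hexp : ∀ i ∈ A, ∀ j ∈ A, (fun c => (f i c - m i) * (f j c - m j)) =
      fun c => f i c * f j c - m j * f i c - m i * f j c + m i * m j := by
    intro i _ j _; funext c; ring
  have hcov : ∀ i ∈ A, ∀ j ∈ A, ∫ c, (f i c - m i) * (f j c - m j) ∂configLaw W p =
      ∫ c, f i c * f j c ∂configLaw W p - m i * m j := by
    intro i hi j hj
    rw [hexp i hi j hj, integral_add, integral_sub, integral_sub, integral_const_mul,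
      integral_const_mul]
    · simp only [integral_const, probReal_univ, one_smul]
      change _ - m j * m i - m i * m j + m i * m j = _
      ring
    · exact hint2 i hi j hj
    · exact (hint i hi).const_mul _
    · exact (hint2 i hi j hj).sub ((hint i hi).const_mul _)
    · exact (hint j hj).const_mul _
    · exact ((hint2 i hi j hj).sub ((hint i hi).const_mul _)).sub ((hint j hj).const_mul _)
    · exact integrable_const _
  have hint3 : ∀ i ∈ A, ∀ j ∈ A,
      Integrable (fun c => (f i c - m i) * (f j c - m j)) (configLaw W p) := by
    intro i hi j hj
    rw [hexp i hi j hj]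
    exact (((hint2 i hi j hj).sub ((hint i hi).const_mul _)).sub ((hint j hj).const_mul _)).add
      (integrable_const _)
  simp_rw [sq (∑ i ∈ A, _), Finset.sum_mul_sum]
  rw [integral_finsetSum _ fun i hi => integrable_finsetSum _ fun j hj => hint3 i hi j hj]
  refine Finset.sum_congr rfl fun i hi => ?_
  -- Only the diagonal survives: functions of disjoint sets of agents have covariance zero.
  rw [integral_finsetSum _ fun j hj => hint3 i hi j hj, Finset.sum_eq_single_of_mem i hi]
  · rw [hcov i hi i hi]
    simp only [sq]
    rfl
  · intro j hj hji
    rw [hcov i hi j hj]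
    have := integral_mul_of_dependsOn (fun _ : W => coordLaw p) (hB hi hj hji.symm) (hf i hi)
      (hf j hj) (hm i hi) (hm j hj)
    rw [sub_eq_zero]
    exact this

end Uncorrelated

/-! ### Estimating an arrival time: pointwise bounds and moments -/

section TimeResolution

theorem integral_unitInterval (F : ℝ → ℝ) :
    ∫ s : unitInterval, F s = ∫ s in (0 : ℝ)..1, F s := by
  rw [intervalIntegral.integral_of_le zero_le_one, ← integral_Icc_eq_integral_Ioc]
  exact integral_subtype measurableSet_Icc F

/-- The integrand is the one-sided Chebyshev bound at arrival time `s`. Its antiderivative is an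
arctangent of total variation below `π`, divided by `2 * √N`. -/
theorem integral_one_div_one_add_sq_le {N : ℝ} (hN : 0 < N) (t : ℝ) :
    ∫ s in (0 : ℝ)..1, 1 / (1 + 4 * N * (s - t) ^ 2) ≤ Real.pi / 2 / Real.sqrt N := by
  have hs : 0 < Real.sqrt N := Real.sqrt_pos.2 hN
  have hsq : Real.sqrt N ^ 2 = N := Real.sq_sqrt hN.le
  have hpos : ∀ s : ℝ, 0 < 1 + 4 * N * (s - t) ^ 2 := fun s => by positivity
  have hd : ∀ s ∈ Set.uIcc (0 : ℝ) 1, HasDerivAt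
      (fun s => Real.arctan (2 * Real.sqrt N * (s - t)) / (2 * Real.sqrt N))
      (1 / (1 + 4 * N * (s - t) ^ 2)) s := by
    intro s _
    have h1 : HasDerivAt (fun s : ℝ => 2 * Real.sqrt N * (s - t)) (2 * Real.sqrt N * 1) s :=
      ((hasDerivAt_id s).sub_const t).const_mul _
    refine (h1.arctan.div_const (2 * Real.sqrt N)).congr_deriv ?_
    rw [show (2 * Real.sqrt N * (s - t)) ^ 2 = 4 * N * (s - t) ^ 2 by
      rw [← hsq]; simp only [Real.sqrt_sq hs.le]; ring]
    have := hpos s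
    field_simp
  rw [intervalIntegral.integral_eq_sub_of_hasDerivAt hd]
  · rw [← sub_div]
    have h1 := Real.arctan_lt_pi_div_two (2 * Real.sqrt N * (1 - t))
    have h2 := Real.neg_pi_div_two_lt_arctan (2 * Real.sqrt N * (0 - t))
    rw [div_div, div_le_div_iff₀ (by positivity) (by positivity)]
    nlinarith
  · refine ContinuousOn.intervalIntegrable (Continuous.continuousOn ?_)
    exact continuous_const.div (by fun_prop) fun s => (hpos s).ne'

/-- The weight that agents who have seen the fraction `a` of their friends receive: it compensates
for the probability `1 - a` of not having seen one more friend, and it is cut off at time `t`. -/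
noncomputable def cutoffWeight (t a : ℝ) : ℝ := if a < t then 1 / (1 - a) else 0

theorem cutoffWeight_nonneg {t a : ℝ} (ht : t < 1) : 0 ≤ cutoffWeight t a := by
  unfold cutoffWeight
  split_ifs with h
  · exact one_div_nonneg.2 (by linarith)
  · exact le_rfl

theorem cutoffWeight_le {t a : ℝ} (ht : t < 1) : cutoffWeight t a ≤ 1 / (1 - t) := by
  unfold cutoffWeight
  split_ifs with h
  · exact one_div_le_one_div_of_le (by linarith) (by linarith)
  · exact one_div_nonneg.2 (by linarith)

/-- If `a` and `s` lie on different sides of `t`, the error is at most `1`. If both lie below `t`,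
it is `|a - s| / (1 - a)`; if neither does, it vanishes. -/
theorem abs_cutoffWeight_sub_le {t a s : ℝ} (ht : t < 1) (hs1 : s ≤ 1) :
    |cutoffWeight t a * (1 - s) - (if s < t then 1 else 0)| ≤
      (if (a < t) = (s < t) then 0 else 1) + |a - s| / (1 - t) := by
  have h1t : 0 < 1 - t := by linarith
  unfold cutoffWeight
  by_cases ha : a < t <;> by_cases hs : s < t
  · have h1a : 0 < 1 - a := by linarith
    simp only [ha, hs, if_true, zero_add]
    rw [show 1 / (1 - a) * (1 - s) - 1 = (a - s) / (1 - a) by field_simp; ring, abs_div,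
      abs_of_pos h1a]
    gcongr
  · have h1a : 0 < 1 - a := by linarith
    simp only [ha, hs, if_true, if_false, sub_zero]
    have h0 : 0 ≤ |a - s| / (1 - t) := by positivity
    rw [abs_of_nonneg (mul_nonneg (one_div_nonneg.2 h1a.le) (by linarith))]
    have : 1 / (1 - a) * (1 - s) ≤ 1 := by
      rw [one_div_mul_eq_div, div_le_one h1a]; linarith
    rw [if_neg (by simp)]
    linarith
  · have h0 : 0 ≤ |a - s| / (1 - t) := by positivity
    simp [ha, hs]
    linarith
  · have h0 : 0 ≤ |a - s| / (1 - t) := by positivity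
    simp [ha, hs]
    linarith

/-- A one-sided Chebyshev bound, pointwise. -/
theorem mismatch_le {t a s b : ℝ} (hb : 0 < b) (hst : s ≠ t) :
    (if (a < t) = (s < t) then (0 : ℝ) else 1) ≤
      ((if s < t then a - s else s - a) + b) ^ 2 / (|s - t| + b) ^ 2 := by
  have hpos : 0 < |s - t| + b := by positivity
  split_ifs with h h' h'
  · positivity
  · positivity
  · have ha : ¬ a < t := fun ha => h (by simp [ha, h'])
    rw [one_le_div (by positivity), abs_of_neg (by linarith)]
    apply pow_le_pow_left₀ (by linarith)
    linarith
  · have ha : a < t := by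
      by_contra ha
      exact h (by simp [ha, h'])
    rw [one_le_div (by positivity), abs_of_nonneg (by linarith)]
    apply pow_le_pow_left₀ (by linarith)
    linarith

variable {W : Type*} [Fintype W] (p : unitInterval)

/-- The number of agents in `A` who arrive before time `s`. -/
noncomputable def arrivedBefore {W : Type*} (A : Finset W) (c : W → Coord) (s : unitInterval) : ℝ :=
  ∑ w ∈ A, if time c w < s then 1 else 0

theorem measurable_indicator_time {W : Type*} (w : W) (s : unitInterval) :
    Measurable fun c : W → Coord => if time c w < s then (1 : ℝ) else 0 :=
  Measurable.ite (measurableSet_lt (measurable_time w) measurable_const) measurable_const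
    measurable_const

theorem integral_indicator_time (w : W) (s : unitInterval) :
    ∫ c, (if time c w < s then (1 : ℝ) else 0) ∂configLaw W p = s := by
  have h1 := (measurePreserving_eval (fun _ : W => coordLaw p) w)
  have hm : Measurable fun x : Coord => if x.2.1 < s then (1 : ℝ) else 0 :=
    Measurable.ite (measurableSet_lt (by fun_prop) measurable_const) measurable_const
      measurable_const
  have h2 : ∫ c, (if time c w < s then (1 : ℝ) else 0) ∂configLaw W p =
      ∫ x, (if x.2.1 < s then (1 : ℝ) else 0) ∂coordLaw p := by
    rw [← h1.map_eq, integral_map h1.measurable.aemeasurable hm.aestronglyMeasurable]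
    rfl
  rw [h2, integral_coordLaw p (g := fun x => if x < s then (1 : ℝ) else 0)
    (Measurable.ite measurableSet_Iio measurable_const measurable_const)]
  have : (fun x : unitInterval => if x < s then (1 : ℝ) else 0) =
      (Set.Iio s).indicator fun _ => 1 := by
    funext x; simp [Set.indicator_apply]
  rw [this, integral_indicator measurableSet_Iio, setIntegral_const, measureReal_def,
    unitInterval.volume_Iio]
  simp [s.2.1]

theorem measurable_arrivedBefore {W : Type*} (A : Finset W) (s : unitInterval) :
    Measurable fun c : W → Coord => arrivedBefore A c s :=
  Finset.measurable_fun_sum _ fun w _ => measurable_indicator_time w s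

theorem arrivedBefore_nonneg {W : Type*} (A : Finset W) (c : W → Coord) (s : unitInterval) :
    0 ≤ arrivedBefore A c s :=
  Finset.sum_nonneg fun w _ => by split_ifs <;> simp

theorem arrivedBefore_le {W : Type*} (A : Finset W) (c : W → Coord) (s : unitInterval) :
    arrivedBefore A c s ≤ A.card := by
  refine (Finset.sum_le_card_nsmul _ _ 1 fun w _ => ?_).trans (by simp)
  split_ifs <;> simp

theorem integral_arrivedBefore (A : Finset W) (s : unitInterval) :
    ∫ c, arrivedBefore A c s ∂configLaw W p = A.card * s := by
  unfold arrivedBefore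
  rw [integral_finsetSum _ fun w _ => Integrable.of_bound
    (measurable_indicator_time w s).aestronglyMeasurable 1
    (Filter.Eventually.of_forall fun c => by split_ifs <;> simp)]
  simp [integral_indicator_time]

theorem integral_arrivedBefore_sub_sq_le (A : Finset W) (s : unitInterval) :
    ∫ c, (arrivedBefore A c s - A.card * s) ^ 2 ∂configLaw W p ≤ A.card / 4 := by
  have h := integral_sum_sub_sq p A (fun w c => if time c w < s then (1 : ℝ) else 0)
    (fun w => {w}) (fun i _ j _ hij => by simpa [Function.onFun] using hij)
    (fun w _ c c' hc => by
      change (if (c w).2.1 < s then (1 : ℝ) else 0) = if (c' w).2.1 < s then 1 else 0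
      rw [hc w rfl])
    (fun w _ => measurable_indicator_time w s)
    (fun w _ c => by split_ifs <;> simp)
  simp only [integral_indicator_time, ite_pow, one_pow, ne_eq, OfNat.ofNat_ne_zero,
    not_false_eq_true, zero_pow, Finset.sum_sub_distrib, Finset.sum_const, nsmul_eq_mul] at h
  have h2 : ∀ c : W → Coord, (∑ w ∈ A, if time c w < s then (1 : ℝ) else 0) = arrivedBefore A c s :=
    fun _ => rfl
  simp only [h2] at h
  rw [h]
  -- Each indicator has variance `s - s ^ 2`, which is at most `1 / 4`.
  nlinarith [sq_nonneg ((s : ℝ) - 1 / 2), (Nat.cast_nonneg A.card : (0 : ℝ) ≤ A.card)]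

end TimeResolution

/-! ### Estimating an arrival time: mean error of the cutoff weight -/

section TimeFromCounts

variable {W : Type*} [Fintype W] (p : unitInterval)

/-- The observed fraction is unbiased, so the linear term disappears whatever the sign of `β`, and
its variance is at most `1 / (4 * A.card)`. -/
theorem integral_le_of_le_quadratic {A : Finset W} (hA : 0 < A.card) (s : unitInterval)
    {α β γ : ℝ} (hα : 0 ≤ α) {F : (W → Coord) → ℝ} (hF0 : ∀ c, 0 ≤ F c)
    (hF : ∀ c, F c ≤ α * (arrivedBefore A c s / A.card - s) ^ 2 +
      β * (arrivedBefore A c s / A.card - s) + γ) :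
    ∫ c, F c ∂configLaw W p ≤ α * (1 / (4 * A.card)) + γ := by
  have hn : (0 : ℝ) < A.card := by exact_mod_cast hA
  set X : (W → Coord) → ℝ := fun c => arrivedBefore A c s / A.card - s with hX
  have hXm : Measurable X := ((measurable_arrivedBefore A s).div_const _).sub_const _
  have hXb : ∀ c, |X c| ≤ 1 := by
    intro c
    have h1 := div_nonneg (arrivedBefore_nonneg A c s) hn.le
    have h2 := (div_le_one hn).2 (arrivedBefore_le A c s)
    have h3 := s.2.1
    have h4 := s.2.2
    rw [abs_le]
    constructor <;> simp only [hX] <;> linarith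
  have hi1 : Integrable X (configLaw W p) := Integrable.of_bound hXm.aestronglyMeasurable 1
    (Filter.Eventually.of_forall hXb)
  have hi2 : Integrable (fun c => X c ^ 2) (configLaw W p) :=
    Integrable.of_bound (hXm.pow_const 2).aestronglyMeasurable 1
      (Filter.Eventually.of_forall fun c => by
        rw [Real.norm_eq_abs, abs_pow]
        exact pow_le_one₀ (abs_nonneg _) (hXb c))
  have e1 : ∫ c, X c ∂configLaw W p = 0 := by
    rw [hX, integral_sub _ (integrable_const _), integral_div, integral_arrivedBefore]
    · simp only [integral_const, probReal_univ, one_smul]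
      field_simp
      ring
    · exact (Integrable.of_bound (measurable_arrivedBefore A s).aestronglyMeasurable A.card
        (Filter.Eventually.of_forall fun c => by
          rw [Real.norm_eq_abs, abs_of_nonneg (arrivedBefore_nonneg A c s)]
          exact arrivedBefore_le A c s)).div_const _
  have e2 : ∫ c, X c ^ 2 ∂configLaw W p ≤ 1 / (4 * A.card) := by
    have h1 : ∀ c, X c ^ 2 = (arrivedBefore A c s - A.card * s) ^ 2 / (A.card : ℝ) ^ 2 := by
      intro c
      simp only [hX]
      field_simp
    simp_rw [h1]
    rw [integral_div]
    refine (div_le_div_of_nonneg_right (integral_arrivedBefore_sub_sq_le p A s)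
      (by positivity)).trans (le_of_eq ?_)
    field_simp
  have hq : Integrable (fun c => α * X c ^ 2 + β * X c + γ) (configLaw W p) :=
    ((hi2.const_mul α).add (hi1.const_mul β)).add (integrable_const γ)
  refine (integral_mono_of_nonneg (Filter.Eventually.of_forall hF0) hq
    (Filter.Eventually.of_forall hF)).trans ?_
  rw [integral_add (f := fun c => α * X c ^ 2 + β * X c) ((hi2.const_mul α).add
    (hi1.const_mul β)) (integrable_const γ), integral_add (hi2.const_mul α) (hi1.const_mul β), integral_const_mul, integral_const_mul, e1]
  simp only [integral_const, probReal_univ, one_smul, mul_zero, add_zero]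
  gcongr

/-- Both terms of `abs_cutoffWeight_sub_le` are dominated by quadratics in the deviation of the
observed fraction: the mismatch by `mismatch_le`, the absolute deviation by the arithmetic-geometric
mean inequality `habs`. -/
theorem integral_abs_cutoffWeight_sub_le_of_time {A : Finset W} (hA : 0 < A.card)
    (s : unitInterval) {t : ℝ} (ht : t < 1) :
    ∫ c, |cutoffWeight t (arrivedBefore A c s / A.card) * (1 - s) -
        (if (s : ℝ) < t then 1 else 0)| ∂configLaw W p ≤
      1 / (1 + 4 * A.card * ((s : ℝ) - t) ^ 2) +
        1 / (2 * (1 - t)) / Real.sqrt A.card := by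
  have hn : (0 : ℝ) < A.card := by exact_mod_cast hA
  have h1t : 0 < 1 - t := by linarith
  set N : ℝ := (A.card : ℝ) with hN
  have hs : 0 < Real.sqrt N := Real.sqrt_pos.2 hn
  have hsq : Real.sqrt N * Real.sqrt N = N := Real.mul_self_sqrt hn.le
  have habs : ∀ x : ℝ, |x| ≤ Real.sqrt N * x ^ 2 + 1 / (4 * Real.sqrt N) := by
    intro x
    have h1 : 0 ≤ (2 * Real.sqrt N * |x| - 1) ^ 2 / (4 * Real.sqrt N) := by positivity
    have h2 : (2 * Real.sqrt N * |x| - 1) ^ 2 / (4 * Real.sqrt N) =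
        Real.sqrt N * |x| ^ 2 + 1 / (4 * Real.sqrt N) - |x| := by
      field_simp
      ring
    rw [sq_abs] at h2
    linarith
  have hdev : ∀ c : W → Coord, |arrivedBefore A c s / N - s| / (1 - t) ≤
      Real.sqrt N / (1 - t) * (arrivedBefore A c s / N - s) ^ 2 +
        1 / (4 * Real.sqrt N) / (1 - t) := by
    intro c
    rw [div_mul_eq_mul_div, ← add_div]
    exact div_le_div_of_nonneg_right (habs _) h1t.le
  have hfin : Real.sqrt N / (1 - t) * (1 / (4 * N)) + 1 / (4 * Real.sqrt N) / (1 - t) =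
      1 / (2 * (1 - t)) / Real.sqrt N := by
    rw [show 1 / (4 * N) = 1 / (4 * (Real.sqrt N * Real.sqrt N)) by rw [hsq]]
    field_simp
    ring
  -- At `s = t` the mismatch is bounded trivially by `1`, which is what the first term of the claim
  -- equals there.
  by_cases hst : (s : ℝ) = t
  · refine (integral_le_of_le_quadratic p hA s (α := Real.sqrt N / (1 - t)) (β := 0)
      (γ := 1 + 1 / (4 * Real.sqrt N) / (1 - t)) (by positivity) (fun c => abs_nonneg _)
      fun c => ?_).trans (le_of_eq ?_)
    · refine (abs_cutoffWeight_sub_le ht s.2.2).trans ?_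
      have h1 := hdev c
      have h2 : (if (arrivedBefore A c s / N < t) = ((s : ℝ) < t) then (0 : ℝ) else 1) ≤ 1 := by
        split_ifs <;> norm_num
      linarith
    · rw [hst, ← hfin]
      ring
  · set l : ℝ := |(s : ℝ) - t| with hl
    have hlpos : 0 < l := abs_pos.2 (sub_ne_zero.2 hst)
    -- This is the optimal shift in the one-sided Chebyshev bound, variance over distance; it turns
    -- `(1 / (4 * N) + b ^ 2) / (l + b) ^ 2` into `1 / (1 + 4 * N * l ^ 2)`.
    set b : ℝ := 1 / (4 * N * l) with hb
    have hbpos : 0 < b := by positivity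
    refine (integral_le_of_le_quadratic p hA s
      (α := 1 / (l + b) ^ 2 + Real.sqrt N / (1 - t))
      (β := (if (s : ℝ) < t then 1 else -1) * (2 * b / (l + b) ^ 2))
      (γ := b ^ 2 / (l + b) ^ 2 + 1 / (4 * Real.sqrt N) / (1 - t)) (by positivity)
      (fun c => abs_nonneg _) fun c => ?_).trans (le_of_eq ?_)
    · refine (abs_cutoffWeight_sub_le ht s.2.2).trans ?_
      have h1 := hdev c
      have h2 := mismatch_le (t := t) (a := arrivedBefore A c s / N) hbpos hst
      have h3 : ((if (s : ℝ) < t then arrivedBefore A c s / N - s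
          else s - arrivedBefore A c s / N) + b) ^ 2 / (l + b) ^ 2 =
          1 / (l + b) ^ 2 * (arrivedBefore A c s / N - s) ^ 2 +
          (if (s : ℝ) < t then 1 else -1) * (2 * b / (l + b) ^ 2) *
            (arrivedBefore A c s / N - s) + b ^ 2 / (l + b) ^ 2 := by
        split_ifs <;> field_simp <;> ring
      rw [← hl, h3] at h2
      linarith
    · have h4 : 1 / (l + b) ^ 2 * (1 / (4 * N)) + b ^ 2 / (l + b) ^ 2 =
          1 / (1 + 4 * N * ((s : ℝ) - t) ^ 2) := by
        rw [← sq_abs ((s : ℝ) - t), ← hl, hb]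
        field_simp
        ring
      rw [← h4, ← hfin]
      ring

theorem measurable_cutoffWeight (t : ℝ) : Measurable (cutoffWeight t) :=
  Measurable.ite measurableSet_Iio (by fun_prop) measurable_const

theorem measurable_arrivedBefore_time {W : Type*} (A : Finset W) (u : W) :
    Measurable fun c : W → Coord => arrivedBefore A c (time c u) :=
  Finset.measurable_fun_sum _ fun w _ =>
    Measurable.ite (measurableSet_lt (measurable_time w) (measurable_time u)) measurable_const
      measurable_const

theorem measurable_coe_time {W : Type*} (u : W) :
    Measurable fun c : W → Coord => (time c u : ℝ) :=
  (measurable_time u).subtype_val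

theorem measurable_indicator_coe_time {W : Type*} (u : W) (t : ℝ) :
    Measurable fun c : W → Coord => if (time c u : ℝ) < t then (1 : ℝ) else 0 :=
  Measurable.ite (measurableSet_lt (measurable_coe_time u) measurable_const) measurable_const
    measurable_const

/-- An agent can tell from the number of friends he observes whether he arrives before time `t`, up
to an error of the order of the inverse square root of the number of friends. -/
theorem integral_abs_cutoffWeight_sub_le {A : Finset W} {u : W} (hu : u ∉ A)
    {t : ℝ} (ht0 : 0 < t) (ht1 : t < 1) :
    ∫ c, |cutoffWeight t (arrivedBefore A c (time c u) / A.card) * (1 - time c u) -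
        (if (time c u : ℝ) < t then 1 else 0)| ∂configLaw W p ≤
      (Real.pi / 2 + 1 / (2 * (1 - t))) / Real.sqrt (max A.card 1 : ℕ) := by
  classical
  have h1t : 0 < 1 - t := by linarith
  -- Without friends the fraction is `0 / 0 = 0` and the weight is `1`; the error is at most `1 < π
  -- / 2`. This case is the reason for the `max` in the bound.
  rcases Nat.eq_zero_or_pos A.card with h0 | hA
  · have hb : ∀ c : W → Coord, ‖|cutoffWeight t (arrivedBefore A c (time c u) / A.card) *
        (1 - time c u) - (if (time c u : ℝ) < t then 1 else 0)|‖ ≤ 1 := by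
      intro c
      rw [h0, Nat.cast_zero, div_zero, cutoffWeight, if_pos ht0, Real.norm_eq_abs, abs_abs,
        abs_le]
      have h1 := (time c u).2.1
      have h2 := (time c u).2.2
      constructor <;> split_ifs <;> linarith
    have h1 := norm_integral_le_of_norm_le_const (μ := configLaw W p)
      (Filter.Eventually.of_forall hb)
    rw [probReal_univ, mul_one] at h1
    refine (le_abs_self _).trans (h1.trans ?_)
    rw [h0]
    have h2 : (0 : ℝ) ≤ 1 / (2 * (1 - t)) := by positivity
    simp only [Nat.zero_le, sup_of_le_right, Nat.cast_one, Real.sqrt_one, div_one]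
    linarith [Real.pi_gt_three]
  · have hn : (0 : ℝ) < A.card := by exact_mod_cast hA
    rw [max_eq_left (Nat.succ_le_of_lt hA)]
    have hm : Measurable fun c : W → Coord =>
        |cutoffWeight t (arrivedBefore A c (time c u) / A.card) * (1 - time c u) -
          (if (time c u : ℝ) < t then 1 else 0)| :=
      ((((measurable_cutoffWeight t).comp
        ((measurable_arrivedBefore_time A u).div_const _)).mul
          ((measurable_coe_time u).const_sub 1)).sub (measurable_indicator_coe_time u t)).abs
    have hb : ∀ c : W → Coord,
        |(|cutoffWeight t (arrivedBefore A c (time c u) / A.card) * (1 - time c u) -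
          (if (time c u : ℝ) < t then 1 else 0)|)| ≤ 1 / (1 - t) + 1 := by
      intro c
      rw [abs_abs]
      have h1 := (time c u).2.1
      have h2 := (time c u).2.2
      refine (abs_sub _ _).trans (add_le_add ?_ (by split_ifs <;> simp))
      rw [abs_of_nonneg (mul_nonneg (cutoffWeight_nonneg ht1) (by linarith))]
      exact (mul_le_mul (cutoffWeight_le ht1) (sub_le_self 1 h1) (by linarith)
        (by positivity)).trans (by rw [mul_one])
    -- The arrival time of `u` is frozen. As `u ∉ A`, the count keeps its law.
    have key := integral_pi_update (fun _ : W => coordLaw p) u hm hb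
    unfold configLaw
    rw [key]
    have hin : ∀ x : Coord, ∫ c, |cutoffWeight t (arrivedBefore A (Function.update c u x)
          (time (Function.update c u x) u) / A.card) * (1 - time (Function.update c u x) u) -
          (if (time (Function.update c u x) u : ℝ) < t then 1 else 0)| ∂configLaw W p ≤
        1 / (1 + 4 * A.card * ((x.2.1 : ℝ) - t) ^ 2) + 1 / (2 * (1 - t)) / Real.sqrt A.card := by
      intro x
      refine le_trans (le_of_eq ?_) (integral_abs_cutoffWeight_sub_le_of_time p hA x.2.1 ht1)
      congr 1
      funext c
      have e1 : time (Function.update c u x) u = x.2.1 := by simp [time]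
      have e2 : ∀ s, arrivedBefore A (Function.update c u x) s = arrivedBefore A c s := by
        intro s
        refine Finset.sum_congr rfl fun w hw => ?_
        have : w ≠ u := fun h => hu (h ▸ hw)
        change (if (Function.update c u x w).2.1 < s then (1 : ℝ) else 0) =
          if (c w).2.1 < s then 1 else 0
        rw [Function.update_of_ne this]
      rw [e1, e2]
    have hgm : Measurable fun s : unitInterval =>
        1 / (1 + 4 * (A.card : ℝ) * ((s : ℝ) - t) ^ 2) + 1 / (2 * (1 - t)) / Real.sqrt A.card := by
      fun_prop
    have hgi : Integrable (fun x : Coord => 1 / (1 + 4 * (A.card : ℝ) * ((x.2.1 : ℝ) - t) ^ 2) +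
        1 / (2 * (1 - t)) / Real.sqrt A.card) (coordLaw p) := by
      refine Integrable.of_bound
        (hgm.comp (measurable_fst.comp measurable_snd)).aestronglyMeasurable (1 + 1 / (2 * (1 - t)) / Real.sqrt A.card)
        (Filter.Eventually.of_forall fun x => ?_)
      rw [Real.norm_eq_abs, abs_of_nonneg (by positivity)]
      have : (1 : ℝ) / (1 + 4 * (A.card : ℝ) * ((x.2.1 : ℝ) - t) ^ 2) ≤ 1 := by
        rw [div_le_one (by positivity)]
        have : 0 ≤ 4 * (A.card : ℝ) * ((x.2.1 : ℝ) - t) ^ 2 := by positivity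
        linarith
      linarith
    refine (integral_mono_of_nonneg (Filter.Eventually.of_forall fun x =>
      integral_nonneg fun c => abs_nonneg _) hgi (Filter.Eventually.of_forall hin)).trans ?_
    rw [integral_coordLaw p hgm, integral_unitInterval (fun s =>
      1 / (1 + 4 * (A.card : ℝ) * (s - t) ^ 2) + 1 / (2 * (1 - t)) / Real.sqrt A.card),
      intervalIntegral.integral_add, intervalIntegral.integral_const, add_div]
    · simp only [sub_zero, one_smul]
      exact add_le_add (integral_one_div_one_add_sq_le hn t) le_rfl
    · refine ContinuousOn.intervalIntegrable (Continuous.continuousOn ?_)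
      exact continuous_const.div (by fun_prop) fun s => by positivity
    · exact intervalIntegrable_const

end TimeFromCounts

/-! ### Expected local action of a friend before a given time -/

section LocalMean

variable {W : Type*}

/-- The payoff `1` of a correct and `-1` of an incorrect action. -/
def score (θ a : Bool) : ℝ := if a = θ then 1 else -1

theorem abs_score (θ a : Bool) : |score θ a| = 1 := by
  unfold score; split_ifs <;> simp

theorem measurable_score_comp {Ω : Type*} [MeasurableSpace Ω] (θ : Bool) {f : Ω → Bool}
    (hf : Measurable f) : Measurable fun ω => score θ (f ω) :=
  (measurable_of_finite (score θ)).comp hf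

variable [Fintype W]

/-- Resampling the arrival time of `v` in the event that `v` does not arrive before `u`. -/
theorem integral_mul_indicator_not_lt (p : unitInterval) {u v : W} (huv : u ≠ v)
    {g : (W → Coord) → ℝ} (hg : DependsOn g {v}ᶜ) (hgm : Measurable g) {C : ℝ}
    (hC : ∀ c, |g c| ≤ C) :
    ∫ c, g c * (if time c v < time c u then 0 else 1) ∂configLaw W p =
      ∫ c, g c * (1 - time c u) ∂configLaw W p := by
  classical
  have hC0 : 0 ≤ C := (abs_nonneg _).trans (hC fun _ => (true, 0, 0))
  have hm : Measurable fun c : W → Coord => g c * (if time c v < time c u then (0 : ℝ) else 1) :=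
    hgm.mul (Measurable.ite (measurableSet_lt (measurable_time v) (measurable_time u))
      measurable_const measurable_const)
  have hb : ∀ c : W → Coord, |g c * (if time c v < time c u then (0 : ℝ) else 1)| ≤ C := by
    intro c
    rw [abs_mul]
    split_ifs
    · simpa using hC0
    · simpa using hC c
  have key := integral_pi_update (fun _ : W => coordLaw p) v hm hb
  unfold configLaw
  rw [key]
  have e1 : ∀ (x : Coord) (c : W → Coord), g (Function.update c v x) *
      (if time (Function.update c v x) v < time (Function.update c v x) u then (0 : ℝ) else 1) =
      g c * (if x.2.1 < time c u then (0 : ℝ) else 1) := by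
    intro x c
    rw [hg (x := Function.update c v x) (y := c)
      fun i hi => Function.update_of_ne (by simpa using hi) _ _]
    exact congrArg (g c * ·) (if_congr
      (by simp only [time, Function.update_self, Function.update_of_ne huv]) rfl rfl)
  simp_rw [e1]
  -- With the arrival time of `v` integrated first, the indicator becomes `1 - time c u`.
  rw [integral_integral_swap]
  · refine integral_congr_ae (Filter.Eventually.of_forall fun c => ?_)
    dsimp only
    rw [integral_const_mul, integral_coordLaw p (g := fun s => if s < time c u then (0 : ℝ) else 1)
      (Measurable.ite measurableSet_Iio measurable_const measurable_const)]
    congr 1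
    have : (fun s : unitInterval => if s < time c u then (0 : ℝ) else 1) =
        (Set.Ici (time c u)).indicator fun _ => 1 := by
      funext s
      by_cases h : s < time c u
      · simp [h]
      · simp [h, not_lt.1 h]
    rw [this, integral_indicator measurableSet_Ici, setIntegral_const, measureReal_def,
      unitInterval.volume_Ici, ENNReal.toReal_ofReal (by linarith [(time c u).2.2])]
    simp
  · refine Integrable.of_bound (C := C) ?_ (Filter.Eventually.of_forall fun x => ?_)
    · refine Measurable.aestronglyMeasurable ?_
      refine (hgm.comp measurable_snd).mul (Measurable.ite (measurableSet_lt ?_ ?_)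
        measurable_const measurable_const)
      · exact measurable_fst.comp (measurable_snd.comp measurable_fst)
      · exact (measurable_time u).comp measurable_snd
    · simp only [Function.uncurry, Real.norm_eq_abs, abs_mul]
      split_ifs
      · simpa using hC0
      · simpa using hC x.2

variable {H : SimpleGraph W}

/-- In a state-symmetric equilibrium the expected score of an agent, weighted with a function of the
set of friends whom he observes, is at least that of his signal. -/
theorem le_integral_score_mul {p : unitInterval} {σ : Profile W}
    (hσ : IsEquilibrium H p σ) (hs : IsStateSymmetric H p σ) (θ : Bool) (u : W)
    (f : Set W → ℝ) (hf : ∀ E, 0 ≤ f E) :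
    (2 * (p : ℝ) - 1) * ∫ c, f (earlier H (time c) u) ∂configLaw W p ≤
      ∫ c, score θ (action H σ (toSample θ c) u) * f (earlier H (time c) u) ∂configLaw W p := by
  classical
  have hEm : ∀ E : Set W, MeasurableSet {c : W → Coord | earlier H (time c) u = E} := fun E =>
    measurableSet_earlier_time H u (fun A => A = E)
  have ham : MeasurableSet {c : W → Coord | action H σ (toSample θ c) u = θ} :=
    measurableSet_eq_fun (measurable_action_toSample H σ θ u) measurable_const
  have e1 : ∀ c : W → Coord, f (earlier H (time c) u) =
      ∑ E : Set W, f E * {c : W → Coord | earlier H (time c) u = E}.indicator 1 c := by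
    intro c
    rw [Finset.sum_eq_single (earlier H (time c) u)]
    · simp
    · intro E _ hE
      simp [hE.symm]
    · simp
  -- The observed set takes finitely many values `E`; on each of them the score is `2 * 1{correct} -
  -- 1`, to which `le_measureReal_correct` applies.
  have e2 : ∀ c : W → Coord, score θ (action H σ (toSample θ c) u) * f (earlier H (time c) u) =
      ∑ E : Set W, f E * (2 * ({c : W → Coord | earlier H (time c) u = E} ∩
        {c | action H σ (toSample θ c) u = θ}).indicator 1 c -
          {c : W → Coord | earlier H (time c) u = E}.indicator 1 c) := by
    intro c
    rw [e1, Finset.mul_sum]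
    refine Finset.sum_congr rfl fun E _ => ?_
    by_cases h1 : earlier H (time c) u = E <;>
      by_cases h2 : action H σ (toSample θ c) u = θ <;>
      simp [score, h1, h2] <;> ring
  have hi : ∀ S : Set (W → Coord), MeasurableSet S →
      Integrable (S.indicator (1 : (W → Coord) → ℝ)) (configLaw W p) := fun S hS =>
    (integrable_const (1 : ℝ)).indicator hS
  have hi2 : ∀ E : Set W, Integrable (fun c => f E * (2 * ({c : W → Coord |
      earlier H (time c) u = E} ∩ {c | action H σ (toSample θ c) u = θ}).indicator 1 c -
          {c : W → Coord | earlier H (time c) u = E}.indicator 1 c)) (configLaw W p) := fun E =>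
    (((hi _ ((hEm E).inter ham)).const_mul 2).sub (hi _ (hEm E))).const_mul _
  simp_rw [e2, e1]
  rw [integral_finsetSum _ fun E _ => (hi _ (hEm E)).const_mul _,
    integral_finsetSum _ fun E _ => hi2 E, Finset.mul_sum]
  refine Finset.sum_le_sum fun E _ => ?_
  rw [integral_const_mul, integral_const_mul, integral_sub ((hi _ ((hEm E).inter ham)).const_mul 2)
    (hi _ (hEm E)), integral_const_mul, integral_indicator_one (hEm E),
    integral_indicator_one ((hEm E).inter ham), mul_left_comm]
  refine mul_le_mul_of_nonneg_left ?_ (hf E)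
  have := le_measureReal_correct hσ hs θ u fun A => A = E
  have e3 : {c : W → Coord | earlier H (time c) u = E} ∩ {c | action H σ (toSample θ c) u = θ} =
    {c | earlier H (time c) u = E ∧ action H σ (toSample θ c) u = θ} := rfl
  rw [e3]
  linarith

/-- The action that `u` takes in the part of the network that he can reach within `r` steps
without passing through `v`. -/
noncomputable def localAction (H : SimpleGraph W) (σ : Profile W) (r : ℕ) (v : W) (θ : Bool)
    (c : W → Coord) (u : W) : Bool :=
  action (edgesWithin H (avoidingBall H v r u)) σ (toSample θ c) u

theorem measurable_localAction (H : SimpleGraph W) (σ : Profile W) (r : ℕ) (v : W) (θ : Bool)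
    (u : W) : Measurable fun c => localAction H σ r v θ c u :=
  measurable_action_toSample _ σ θ u

theorem mem_avoidingBall_self {W : Type*} (H : SimpleGraph W) {v u : W} (huv : u ≠ v) (r : ℕ) :
    u ∈ avoidingBall H v r u :=
  ⟨SimpleGraph.Walk.nil, by simp, by simpa using huv.symm⟩

theorem notMem_avoidingBall {W : Type*} (H : SimpleGraph W) (v u : W) (r : ℕ) : v ∉ avoidingBall H v r u :=
  fun ⟨q, _, hq⟩ => hq q.end_mem_support

theorem dependsOn_localAction (H : SimpleGraph W) (σ : Profile W) (r : ℕ) {v u : W} (huv : u ≠ v)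
    (θ : Bool) : DependsOn (fun c => localAction H σ r v θ c u) (avoidingBall H v r u) :=
  dependsOn_action_edgesWithin H σ θ _ u (mem_avoidingBall_self H huv r)

open Classical in
/-- The expected local score of a friend `u` of `v` on the event that `u` arrives before time `t`
is nearly the one that `u` would obtain by following his signal. -/
theorem le_integral_localScore {p : unitInterval} {σ : Profile W}
    (hσ : IsEquilibrium H p σ) (hs : IsStateSymmetric H p σ) (hp : 1 / 2 ≤ (p : ℝ)) (θ : Bool)
    {u v : W} (huv : H.Adj u v) (r : ℕ) {t : ℝ} (ht0 : 0 < t) (ht1 : t < 1) :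
    (2 * (p : ℝ) - 1) * t -
        (Real.pi + 1 / (1 - t)) / Real.sqrt (max ((H.neighborFinset u).card - 1) 1 : ℕ) -
        2 / (1 - t) * (configLaw W p).real {c | HasDecreasingChain H (time c) r u} ≤
      ∫ c, score θ (localAction H σ r v θ c u) * (if (time c u : ℝ) < t then 1 else 0)
        ∂configLaw W p := by
  have h1t : 0 < 1 - t := by linarith
  -- `v` is left out of the count so that the weight `h` does not depend on his arrival time.
  set A : Finset W := (H.neighborFinset u).erase v with hA
  have hcard : A.card = (H.neighborFinset u).card - 1 :=
    Finset.card_erase_of_mem (by simpa using huv)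
  have huA : u ∉ A := by simp [hA]
  rw [← hcard]
  set N : ℝ := (A.card : ℝ) with hN
  set ε : ℝ := 2 * (p : ℝ) - 1 with hε
  have hε0 : 0 ≤ ε := by linarith
  have hε1 : ε ≤ 1 := by linarith [p.2.2]
  set μ := configLaw W p with hμ
  set h : (W → Coord) → ℝ := fun c => cutoffWeight t (arrivedBefore A c (time c u) / N) with hh
  set Y : (W → Coord) → ℝ := fun c => score θ (action H σ (toSample θ c) u) with hY
  set Y' : (W → Coord) → ℝ := fun c => score θ (localAction H σ r v θ c u) with hY'
  set I : (W → Coord) → ℝ := fun c => if time c v < time c u then 0 else 1 with hI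
  set J : (W → Coord) → ℝ := fun c => if (time c u : ℝ) < t then 1 else 0 with hJ
  set L : Set (W → Coord) := {c | HasDecreasingChain H (time c) r u} with hL
  have hLm : MeasurableSet L := by
    have : ∀ n w, MeasurableSet {c : W → Coord | HasDecreasingChain H (time c) n w} := by
      intro n
      induction n with
      | zero => intro w; exact MeasurableSet.univ
      | succ n ih =>
        intro w
        have e : {c : W → Coord | HasDecreasingChain H (time c) (n + 1) w} =
            ⋃ x, ({_c | H.Adj w x} ∩ ({c | time c x < time c w} ∩
              {c | HasDecreasingChain H (time c) n x})) := by
          ext c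
          simp [HasDecreasingChain]
        rw [e]
        exact MeasurableSet.iUnion fun x => (MeasurableSet.const _).inter
          ((measurableSet_lt (measurable_time x) (measurable_time w)).inter (ih x))
    exact this r u
  have hhm : Measurable h :=
    (measurable_cutoffWeight t).comp ((measurable_arrivedBefore_time A u).div_const _)
  have hYm : Measurable Y := measurable_score_comp θ (measurable_action_toSample H σ θ u)
  have hY'm : Measurable Y' := measurable_score_comp θ (measurable_localAction H σ r v θ u)
  have hIm : Measurable I :=
    Measurable.ite (measurableSet_lt (measurable_time v) (measurable_time u))
      measurable_const measurable_const
  have hJm : Measurable J := measurable_indicator_coe_time u t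
  have hτm : Measurable fun c : W → Coord => 1 - (time c u : ℝ) :=
    (measurable_coe_time u).const_sub 1
  have hh0 : ∀ c, 0 ≤ h c := fun c => cutoffWeight_nonneg ht1
  have hh1 : ∀ c, h c ≤ 1 / (1 - t) := fun c => cutoffWeight_le ht1
  have hI0 : ∀ c, 0 ≤ I c := fun c => by simp only [hI]; split_ifs <;> norm_num
  have hI1 : ∀ c, I c ≤ 1 := fun c => by simp only [hI]; split_ifs <;> norm_num
  have hJ0 : ∀ c, 0 ≤ J c := fun c => by simp only [hJ]; split_ifs <;> norm_num
  have hJ1 : ∀ c, J c ≤ 1 := fun c => by simp only [hJ]; split_ifs <;> norm_num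
  have hτ0 : ∀ c : W → Coord, 0 ≤ 1 - (time c u : ℝ) := fun c => by linarith [(time c u).2.2]
  have hτ1 : ∀ c : W → Coord, 1 - (time c u : ℝ) ≤ 1 := fun c => by linarith [(time c u).2.1]
  have hYa : ∀ c, |Y c| = 1 := fun c => abs_score _ _
  have hY'a : ∀ c, |Y' c| = 1 := fun c => abs_score _ _
  have habs : ∀ a b : ℝ, 0 ≤ b → b ≤ 1 → |a * b| ≤ |a| := fun a b hb0 hb1 => by
    rw [abs_mul, abs_of_nonneg hb0]; exact mul_le_of_le_one_right (abs_nonneg _) hb1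
  have hha : ∀ c, |h c| ≤ 1 / (1 - t) := fun c => by rw [abs_of_nonneg (hh0 c)]; exact hh1 c
  have hYh : ∀ c, |Y c * h c| ≤ 1 / (1 - t) := fun c => by
    rw [abs_mul, hYa, one_mul]; exact hha c
  have hY'h : ∀ c, |Y' c * h c| ≤ 1 / (1 - t) := fun c => by
    rw [abs_mul, hY'a, one_mul]; exact hha c
  have mkInt : ∀ {f : (W → Coord) → ℝ} (C : ℝ), Measurable f → (∀ c, |f c| ≤ C) →
      Integrable f μ := fun C hf hC =>
    Integrable.of_bound hf.aestronglyMeasurable C (Filter.Eventually.of_forall hC)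
  -- `h * I` is a function of the set that `u` observes, so the signal bound survives this
  -- weighting.
  have s1 : ε * ∫ c, h c * I c ∂μ ≤ ∫ c, Y c * h c * I c ∂μ := by
    have := le_integral_score_mul hσ hs θ u (fun E => cutoffWeight t
      ((∑ w ∈ A, if w ∈ E then 1 else 0) / N) * (if v ∈ E then 0 else 1))
      fun E => mul_nonneg (cutoffWeight_nonneg ht1) (by split_ifs <;> norm_num)
    have e1 : ∀ c : W → Coord, cutoffWeight t
        ((∑ w ∈ A, if w ∈ earlier H (time c) u then 1 else 0) / N) *
          (if v ∈ earlier H (time c) u then 0 else 1) = h c * I c := by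
      intro c
      have e2 : (∑ w ∈ A, if w ∈ earlier H (time c) u then (1 : ℝ) else 0) =
          arrivedBefore A c (time c u) := by
        refine Finset.sum_congr rfl fun w hw => ?_
        have : H.Adj u w := by simpa using (Finset.mem_erase.1 hw).2
        exact if_congr (by simp [earlier, this]) rfl rfl
      have e3 : (if v ∈ earlier H (time c) u then (0 : ℝ) else 1) = I c :=
        if_congr (by simp [earlier, huv]) rfl rfl
      rw [e2, e3]
    simp_rw [e1] at this
    simpa only [mul_assoc] using this
  -- Where `I` does not vanish, `v` is not earlier than `u`, so true and local action agree off `L`;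
  -- on `L` both products are at most `1 / (1 - t)` in absolute value.
  have s2 : ∫ c, Y c * h c * I c ∂μ - 2 / (1 - t) * μ.real L ≤ ∫ c, Y' c * h c * I c ∂μ := by
    have hle : ∀ c, Y c * h c * I c ≤ Y' c * h c * I c + 2 / (1 - t) * L.indicator 1 c := by
      intro c
      by_cases hc : c ∈ L
      · rw [Set.indicator_of_mem hc]
        have h1 := (le_abs_self _).trans ((habs _ _ (hI0 c) (hI1 c)).trans (hYh c))
        have h2 := (neg_le_abs _).trans ((habs _ _ (hI0 c) (hI1 c)).trans (hY'h c))
        have h3 : 2 / (1 - t) = 1 / (1 - t) + 1 / (1 - t) := by ring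
        simp only [Pi.one_apply, mul_one]
        linarith
      · rw [Set.indicator_of_notMem hc]
        by_cases hv : time c v < time c u
        · simp [hI, hv]
        · have : action H σ (toSample θ c) u = localAction H σ r v θ c u :=
            action_eq_action_edgesWithin H σ (toSample θ c) v u r huv.ne hv hc
          simp [hY, hY', this]
    have i1 : Integrable (fun c => Y c * h c * I c) μ := mkInt _ ((hYm.mul hhm).mul hIm)
      fun c => (habs _ _ (hI0 c) (hI1 c)).trans (hYh c)
    have i2 : Integrable (fun c => Y' c * h c * I c) μ := mkInt _ ((hY'm.mul hhm).mul hIm)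
      fun c => (habs _ _ (hI0 c) (hI1 c)).trans (hY'h c)
    have i3 : Integrable (fun c => 2 / (1 - t) * L.indicator 1 c) μ :=
      ((integrable_const (1 : ℝ)).indicator hLm).const_mul (2 / (1 - t))
    have hmono : ∫ c, Y c * h c * I c ∂μ ≤
        ∫ c, (Y' c * h c * I c + 2 / (1 - t) * L.indicator 1 c) ∂μ :=
      integral_mono i1 (i2.add i3) hle
    rw [integral_add i2 i3, integral_const_mul, integral_indicator_one hLm] at hmono
    linarith
  have hhd : DependsOn h {v}ᶜ := by
    intro c c' hc
    have htime : ∀ w, w ≠ v → time c w = time c' w := fun w hw => by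
      simp only [time, hc w (by simpa using hw)]
    have e : arrivedBefore A c (time c u) = arrivedBefore A c' (time c' u) := by
      refine Finset.sum_congr rfl fun w hw => ?_
      rw [htime w (Finset.mem_erase.1 hw).1, htime u huv.ne]
    simp only [hh, e]
  have hY'd : DependsOn Y' {v}ᶜ := by
    intro c c' hc
    have : localAction H σ r v θ c u = localAction H σ r v θ c' u :=
      dependsOn_localAction H σ r huv.ne θ fun w hw => hc w (by
        rintro rfl
        exact notMem_avoidingBall H _ u r hw)
    simp only [hY', this]
  -- Neither `h` nor `Y'` involves `v`, so `I` may be averaged to `1 - time c u`; the denominator in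
  -- `cutoffWeight` was chosen to cancel this factor.
  have s3 : ∫ c, h c * I c ∂μ = ∫ c, h c * (1 - time c u) ∂μ :=
    integral_mul_indicator_not_lt p huv.ne hhd hhm hha
  have s4 : ∫ c, Y' c * h c * I c ∂μ = ∫ c, Y' c * h c * (1 - time c u) ∂μ :=
    integral_mul_indicator_not_lt p huv.ne
      (fun c c' hc => by rw [hhd hc, hY'd hc]) (hY'm.mul hhm) hY'h
  have s5 := integral_abs_cutoffWeight_sub_le p huA ht0 ht1
  set err : ℝ := ∫ c, |h c * (1 - time c u) - J c| ∂μ with herr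
  have herrInt : Integrable (fun c => |h c * (1 - time c u) - J c|) μ :=
    mkInt (1 / (1 - t) + 1) (((hhm.mul hτm).sub hJm).abs) fun c => by
      rw [abs_abs]
      refine (abs_sub _ _).trans (add_le_add ((habs _ _ (hτ0 c) (hτ1 c)).trans (hha c)) ?_)
      rw [abs_of_nonneg (hJ0 c)]
      exact hJ1 c
  have hJint : Integrable J μ := mkInt 1 hJm fun c => by rw [abs_of_nonneg (hJ0 c)]; exact hJ1 c
  have s6 : ∫ c, J c ∂μ = t := by
    have := integral_indicator_time p u ⟨t, ht0.le, ht1.le⟩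
    exact this
  have s7 : t - err ≤ ∫ c, h c * (1 - time c u) ∂μ := by
    rw [← s6, herr, ← integral_sub hJint herrInt]
    refine integral_mono (hJint.sub herrInt) (mkInt _ (hhm.mul hτm)
      fun c => (habs _ _ (hτ0 c) (hτ1 c)).trans (hha c)) fun c => ?_
    have := neg_le_abs (h c * (1 - time c u) - J c)
    simp only
    linarith
  have s8 : ∫ c, Y' c * h c * (1 - time c u) ∂μ - err ≤ ∫ c, Y' c * J c ∂μ := by
    have hi1 : Integrable (fun c => Y' c * h c * (1 - time c u)) μ :=
      mkInt _ ((hY'm.mul hhm).mul hτm) fun c => (habs _ _ (hτ0 c) (hτ1 c)).trans (hY'h c)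
    rw [herr, ← integral_sub hi1 herrInt]
    refine integral_mono (hi1.sub herrInt) (mkInt 1 (hY'm.mul hJm)
      fun c => (habs _ _ (hJ0 c) (hJ1 c)).trans (hY'a c).le) fun c => ?_
    have h1 := le_abs_self (Y' c * (h c * (1 - time c u) - J c))
    rw [abs_mul, hY'a, one_mul] at h1
    simp only
    linarith
  have herr0 : 0 ≤ err := integral_nonneg fun c => abs_nonneg _
  -- The approximation error is paid twice, in the mean weight (`s7`) and in the local score (`s8`).
  have s9 : 2 * err ≤ (Real.pi + 1 / (1 - t)) / Real.sqrt (max A.card 1 : ℕ) := by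
    have e : (Real.pi + 1 / (1 - t)) / Real.sqrt (max A.card 1 : ℕ) =
        2 * ((Real.pi / 2 + 1 / (2 * (1 - t))) / Real.sqrt (max A.card 1 : ℕ)) := by
      field_simp
    rw [e]
    exact mul_le_mul_of_nonneg_left s5 zero_le_two
  have s10 : ε * (t - err) ≤ ε * ∫ c, h c * (1 - time c u) ∂μ := mul_le_mul_of_nonneg_left s7 hε0
  have s11 : ε * err ≤ err := mul_le_of_le_one_left herr0 hε1
  rw [s3] at s1
  rw [s4] at s2
  linarith

end LocalMean

/-! ### Following the majority of the observed friends -/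

section Majority

variable {W : Type*} [Fintype W]

theorem ae_device_ne_one (p : unitInterval) (v : W) :
    ∀ᵐ c ∂configLaw W p, (c v).2.2 ≠ 1 := by
  have h2 := measurePreserving_eval (fun _ : W => coordLaw p) v
  have hm : MeasurableSet {x : Coord | x.2.2 = 1} :=
    measurableSet_eq_fun (by fun_prop) measurable_const
  have h4 : coordLaw p {x : Coord | x.2.2 = 1} = 0 := by
    have e : {x : Coord | x.2.2 = 1} = Set.univ ×ˢ (Set.univ ×ˢ {1}) := by
      ext x
      simp
    rw [e, coordLaw, Measure.prod_prod, Measure.prod_prod, measure_singleton]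
    simp
  have h3 := h2.measure_preimage hm.nullMeasurableSet
  rw [h4] at h3
  exact measure_eq_zero_iff_ae_notMem.1 h3

variable (H : SimpleGraph W)

open Classical in
/-- The number of correct minus the number of incorrect actions observed by `v`. -/
noncomputable def observedScore (σ : Profile W) (θ : Bool) (v : W) (c : W → Coord) : ℝ :=
  ∑ u ∈ H.neighborFinset v, score θ (action H σ (toSample θ c) u) *
    (if time c u < time c v then 1 else 0)

open Classical in
/-- The same with the local actions of the friends. -/
noncomputable def localScore (σ : Profile W) (r : ℕ) (θ : Bool) (v : W) (s : unitInterval)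
    (c : W → Coord) : ℝ :=
  ∑ u ∈ H.neighborFinset v, score θ (localAction H σ r v θ c u) *
    (if time c u < s then 1 else 0)

variable {H}

/-- In equilibrium an agent does at least as well as by following the majority of the friends whom
he observes. -/
theorem IsEquilibrium.one_sub_le_agentQuality {p : unitInterval} {σ : Profile W}
    (hσ : IsEquilibrium H p σ) (v : W) {B : ℝ}
    (hB : ∀ θ, (configLaw W p).real {c | observedScore H σ θ v c ≤ 0} ≤ B) :
    1 - B ≤ agentQuality H p σ v := by
  classical
  -- Action `1` is taken only on a strict majority; ties are counted as errors in both states.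
  set τ : Info W → unitInterval := fun i =>
    if 0 < ∑ w, (i.2 w).elim 0 (score true) then 1 else 0 with hτ
  have hsum : ∀ ω : Sample W, ∑ w, ((realizedInfo H σ ω v).2 w).elim 0 (score true) =
      ∑ w ∈ H.neighborFinset v, score true (action H σ ω w) *
        (if arrival ω w < arrival ω v then 1 else 0) := by
    intro ω
    rw [← Finset.sum_subset (Finset.subset_univ (H.neighborFinset v))]
    · refine Finset.sum_congr rfl fun w hw => ?_
      have hw' : H.Adj v w := by simpa using hw
      by_cases h : arrival ω w < arrival ω v <;> simp [realizedInfo, hw', h]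
    · intro w _ hw
      have hw' : ¬ H.Adj v w := by simpa using hw
      simp [realizedInfo, hw']
  set E : Set (Sample W) := {ω | decide (device ω v < τ (realizedInfo H σ ω v)) = state ω} with hE
  have hEm : MeasurableSet E :=
    measurableSet_eq_fun (measurable_decide_realizedInfo H σ v τ) measurable_state
  have key : ∀ θ, 1 - B ≤ (configLaw W p).real {c | toSample θ c ∈ E} := by
    intro θ
    have hm : MeasurableSet {c : W → Coord | toSample θ c ∈ E} := measurable_toSample θ hEm
    have h1 : (configLaw W p).real {c | toSample θ c ∈ E}ᶜ ≤
        (configLaw W p).real {c | observedScore H σ θ v c ≤ 0} := by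
      refine ENNReal.toReal_mono (measure_ne_top _ _) (measure_mono_ae ?_)
      filter_upwards [ae_device_ne_one p v] with c hc hmem
      by_contra hpos
      refine hmem ?_
      have hpos' : 0 < observedScore H σ θ v c := not_le.1 hpos
      change decide (device (toSample θ c) v < τ (realizedInfo H σ (toSample θ c) v)) = θ
      have hdev : device (toSample θ c) v = (c v).2.2 := rfl
      have hs := hsum (toSample θ c)
      cases θ
      · have : ∑ w, ((realizedInfo H σ (toSample false c) v).2 w).elim 0 (score true) =
            - observedScore H σ false v c := by
          rw [hs, observedScore, ← Finset.sum_neg_distrib]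
          refine Finset.sum_congr rfl fun w _ => ?_
          rw [← neg_mul]
          congr 1
          cases action H σ (toSample false c) w <;> simp [score]
        have hτ0 : τ (realizedInfo H σ (toSample false c) v) = 0 := by
          simp only [hτ, this]
          rw [if_neg (by linarith)]
        rw [hτ0]
        simp
      · have hτ1 : τ (realizedInfo H σ (toSample true c) v) = 1 := by
          simp only [hτ, hs]
          exact if_pos hpos'
        rw [hτ1, hdev]
        simpa using lt_of_le_of_ne unitInterval.le_one' hc
    have h2 := probReal_compl_eq_one_sub (μ := configLaw W p) hm
    have h3 := hB θ
    linarith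
  have h4 := hσ.le_agentQuality v τ
  have h5 : (prob W p).real E ≤ agentQuality H p σ v := h4
  rw [measureReal_prob_eq p hEm] at h5
  have h6 := key true
  have h7 := key false
  linarith

variable (H)

open Classical in
/-- The observed score is the local one, unless there is a long decreasing chain. -/
theorem measureReal_observedScore_le (p : unitInterval) (σ : Profile W) (r : ℕ) (θ : Bool) (v : W) :
    (configLaw W p).real {c | observedScore H σ θ v c ≤ 0} ≤
      (∑ u ∈ H.neighborFinset v,
        (configLaw W p).real {c | HasDecreasingChain H (time c) r u}) +
      (configLaw W p).real {c | localScore H σ r θ v (time c v) c ≤ 0} := by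
  have hsub : {c : W → Coord | observedScore H σ θ v c ≤ 0} ⊆
      (⋃ u ∈ H.neighborFinset v, {c | HasDecreasingChain H (time c) r u}) ∪
        {c | localScore H σ r θ v (time c v) c ≤ 0} := by
    intro c hc
    by_cases hch : ∃ u ∈ H.neighborFinset v, HasDecreasingChain H (time c) r u
    · obtain ⟨u, hu, h⟩ := hch
      exact Or.inl (Set.mem_biUnion hu h)
    · refine Or.inr ?_
      have : localScore H σ r θ v (time c v) c = observedScore H σ θ v c := by
        refine Finset.sum_congr rfl fun u hu => ?_
        by_cases ht : time c u < time c v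
        · have hne : u ≠ v := by rintro rfl; simp at hu
          have := action_eq_action_edgesWithin H σ (toSample θ c) v u r hne (lt_asymm ht)
            fun h => hch ⟨u, hu, h⟩
          rw [localAction, ← this]
        · simp [ht]
      change localScore H σ r θ v (time c v) c ≤ 0
      rw [this]
      exact hc
  refine (measureReal_mono hsub (measure_ne_top _ _)).trans ((measureReal_union_le _ _).trans ?_)
  exact add_le_add (measureReal_biUnion_finset_le _ _) le_rfl

theorem measurable_localScore_term (σ : Profile W) (r : ℕ) (θ : Bool) (v u : W)
    (s : unitInterval) : Measurable fun c : W → Coord =>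
      score θ (localAction H σ r v θ c u) * (if time c u < s then (1 : ℝ) else 0) :=
  (measurable_score_comp θ (measurable_localAction H σ r v θ u)).mul
    (measurable_indicator_time u s)

open Classical in
/-- Chebyshev's inequality for the local score. -/
theorem measureReal_localScore_le (p : unitInterval) (σ : Profile W) (r : ℕ) (θ : Bool) (v : W)
    (s : unitInterval)
    (hdisj : (H.neighborFinset v : Set W).PairwiseDisjoint (avoidingBall H v r)) {m : ℝ}
    (hm0 : 0 < m) (hm : m ≤ ∑ u ∈ H.neighborFinset v, ∫ c, score θ (localAction H σ r v θ c u) *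
      (if time c u < s then 1 else 0) ∂configLaw W p) :
    (configLaw W p).real {c | localScore H σ r θ v s c ≤ 0} ≤
      (H.neighborFinset v).card * s / m ^ 2 := by
  set f : W → (W → Coord) → ℝ := fun u c => score θ (localAction H σ r v θ c u) *
      (if time c u < s then (1 : ℝ) else 0) with hf
  set μ := configLaw W p with hμ
  have hne : ∀ u ∈ H.neighborFinset v, u ≠ v := by rintro u hu rfl; simp at hu
  have hfm : ∀ u, Measurable (f u) := fun u => measurable_localScore_term H σ r θ v u s
  have hfb : ∀ u c, |f u c| ≤ 1 := by
    intro u c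
    simp only [hf]
    rw [abs_mul, abs_score, one_mul]
    split_ifs <;> simp
  have hvar := integral_sum_sub_sq p (H.neighborFinset v) f (avoidingBall H v r) hdisj
    (fun u hu c c' hc => by
      have h1 : localAction H σ r v θ c u = localAction H σ r v θ c' u :=
        dependsOn_localAction H σ r (hne u hu) θ hc
      have h2 : time c u = time c' u :=
        congrArg (fun x : Coord => x.2.1) (hc u (mem_avoidingBall_self H (hne u hu) r))
      simp only [hf, h1, h2])
    (fun u _ => hfm u) (fun u _ => hfb u)
  have hvar_le : ∫ c, (∑ u ∈ H.neighborFinset v, (f u c - ∫ x, f u x ∂μ)) ^ 2 ∂μ ≤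
      (H.neighborFinset v).card * s := by
    rw [hvar]
    refine (Finset.sum_le_card_nsmul _ _ (s : ℝ) fun u _ => ?_).trans (by rw [nsmul_eq_mul])
    -- A score squares to one, so the second moment is the probability of arriving before `s`.
    have e : ∫ c, f u c ^ 2 ∂μ = s := by
      rw [← integral_indicator_time p u s]
      refine integral_congr_ae (Filter.Eventually.of_forall fun c => ?_)
      simp only [hf]
      rw [mul_pow, ← sq_abs (score _ _), abs_score]
      split_ifs <;> simp
    rw [e]
    linarith [sq_nonneg (∫ c, f u c ∂μ)]
  have hSm : Measurable fun c => ∑ u ∈ H.neighborFinset v, (f u c - ∫ x, f u x ∂μ) :=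
    Finset.measurable_fun_sum _ fun u _ => (hfm u).sub_const _
  have hint : Integrable (fun c => (∑ u ∈ H.neighborFinset v, (f u c - ∫ x, f u x ∂μ)) ^ 2) μ := by
    refine Integrable.of_bound (hSm.pow_const 2).aestronglyMeasurable
      (((H.neighborFinset v).card • (2 : ℝ)) ^ 2) (Filter.Eventually.of_forall fun c => ?_)
    rw [Real.norm_eq_abs, abs_pow]
    refine pow_le_pow_left₀ (abs_nonneg _) ((Finset.abs_sum_le_sum_abs _ _).trans
      (Finset.sum_le_card_nsmul _ _ 2 fun u _ => ?_)) 2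
    have h1 : |∫ x, f u x ∂μ| ≤ 1 := by
      have := norm_integral_le_of_norm_le_const (μ := μ) (f := f u) (C := 1)
        (Filter.Eventually.of_forall fun c => hfb u c)
      simpa using this
    exact (abs_sub _ _).trans (by linarith [hfb u c])
  have hmarkov := mul_meas_ge_le_integral_of_nonneg (μ := μ)
    (Filter.Eventually.of_forall fun c => sq_nonneg
      (∑ u ∈ H.neighborFinset v, (f u c - ∫ x, f u x ∂μ))) hint (m ^ 2)
  have hsub : {c | localScore H σ r θ v s c ≤ 0} ⊆
      {c | m ^ 2 ≤ (∑ u ∈ H.neighborFinset v, (f u c - ∫ x, f u x ∂μ)) ^ 2} := by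
    intro c hc
    have hc' : ∑ u ∈ H.neighborFinset v, f u c ≤ 0 := hc
    change m ^ 2 ≤ (∑ u ∈ H.neighborFinset v, (f u c - ∫ x, f u x ∂μ)) ^ 2
    rw [Finset.sum_sub_distrib, ← neg_sq (_ - _)]
    refine pow_le_pow_left₀ hm0.le ?_ 2
    linarith
  rw [le_div_iff₀ (by positivity), mul_comm]
  refine (mul_le_mul_of_nonneg_left (measureReal_mono hsub (measure_ne_top _ _))
    (by positivity)).trans (hmarkov.trans hvar_le)

/-- The local score at the random arrival time of `v`. -/
theorem measureReal_localScore_time (p : unitInterval) (σ : Profile W) (r : ℕ) (θ : Bool) (v : W)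
    {g : unitInterval → ℝ} (hg : Measurable g) {C : ℝ} (hC : ∀ s, |g s| ≤ C)
    (h : ∀ s, (configLaw W p).real {c | localScore H σ r θ v s c ≤ 0} ≤ g s) :
    (configLaw W p).real {c | localScore H σ r θ v (time c v) c ≤ 0} ≤ ∫ s, g s := by
  classical
  have hSm : Measurable fun c : W → Coord => localScore H σ r θ v (time c v) c :=
    Finset.measurable_fun_sum _ fun u _ =>
      (measurable_score_comp θ (measurable_localAction H σ r v θ u)).mul
        (Measurable.ite (measurableSet_lt (measurable_time u) (measurable_time v))
          measurable_const measurable_const)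
  have hm : MeasurableSet {c : W → Coord | localScore H σ r θ v (time c v) c ≤ 0} :=
    measurableSet_le hSm measurable_const
  have hsm : ∀ s, MeasurableSet {c : W → Coord | localScore H σ r θ v s c ≤ 0} := fun s =>
    measurableSet_le (Finset.measurable_fun_sum _ fun u _ =>
      measurable_localScore_term H σ r θ v u s) measurable_const
  rw [← integral_indicator_one hm]
  have key := integral_pi_update (fun _ : W => coordLaw p) v
    (f := {c : W → Coord | localScore H σ r θ v (time c v) c ≤ 0}.indicator 1)
    (measurable_one.indicator hm) (C := 1)
    (fun c => by by_cases hc : c ∈ {c : W → Coord | localScore H σ r θ v (time c v) c ≤ 0} <;>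
      simp [hc])
  unfold configLaw at h ⊢
  rw [key, ← integral_coordLaw p hg]
  refine integral_mono_of_nonneg (Filter.Eventually.of_forall fun x => integral_nonneg fun c =>
    Set.indicator_nonneg (fun _ _ => zero_le_one) _)
    (Integrable.of_bound (hg.comp (measurable_fst.comp measurable_snd)).aestronglyMeasurable C
      (Filter.Eventually.of_forall fun x => hC _)) (Filter.Eventually.of_forall fun x => ?_)
  refine le_trans (le_of_eq ?_) (h x.2.1)
  rw [← integral_indicator_one (hsm x.2.1)]
  refine integral_congr_ae (Filter.Eventually.of_forall fun c => ?_)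
  -- The balls avoid `v`, so his coordinate enters only through the time at which the score is
  -- evaluated.
  have e : localScore H σ r θ v (time (Function.update c v x) v) (Function.update c v x) =
      localScore H σ r θ v x.2.1 c := by
    refine Finset.sum_congr rfl fun u hu => ?_
    have hne : u ≠ v := by rintro rfl; simp at hu
    have h1 : localAction H σ r v θ (Function.update c v x) u = localAction H σ r v θ c u :=
      dependsOn_localAction H σ r hne θ fun w hw => Function.update_of_ne (by
        rintro rfl
        exact notMem_avoidingBall H _ u r hw) _ _
    rw [h1]
    exact congrArg (_ * ·) (if_congr
      (by simp only [time, Function.update_self, Function.update_of_ne hne]) rfl rfl)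
  simp only [Set.indicator_apply, Set.mem_ofPred_eq, e, Pi.one_apply]

end Majority

/-! ### Error probability of one agent -/

section AgentBound

theorem integral_indicator_lt_le {a : ℝ} (ha : 0 ≤ a) :
    ∫ s : unitInterval, (if (s : ℝ) < a then (1 : ℝ) else 0) ≤ a := by
  have e : (fun s : unitInterval => if (s : ℝ) < a then (1 : ℝ) else 0) =
      {s : unitInterval | (s : ℝ) < a}.indicator 1 := by
    funext s; simp [Set.indicator_apply]
  rw [e, integral_indicator_one (measurableSet_lt (by fun_prop) measurable_const)]
  rcases le_or_gt a 1 with h | h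
  · have : {s : unitInterval | (s : ℝ) < a} = Set.Iio ⟨a, ha, h⟩ := rfl
    rw [this, measureReal_def, unitInterval.volume_Iio, ENNReal.toReal_ofReal ha]
  · exact measureReal_le_one.trans h.le

theorem integral_indicator_gt_le {a : ℝ} (ha : 0 ≤ a) :
    ∫ s : unitInterval, (if 1 - a < (s : ℝ) then (1 : ℝ) else 0) ≤ a := by
  have e : (fun s : unitInterval => if 1 - a < (s : ℝ) then (1 : ℝ) else 0) =
      {s : unitInterval | 1 - a < (s : ℝ)}.indicator 1 := by
    funext s; simp [Set.indicator_apply]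
  rw [e, integral_indicator_one (measurableSet_lt measurable_const (by fun_prop))]
  rcases le_or_gt a 1 with h | h
  · have : {s : unitInterval | 1 - a < (s : ℝ)} = Set.Ioi ⟨1 - a, by linarith, by linarith⟩ := rfl
    rw [this, measureReal_def, unitInterval.volume_Ioi, ENNReal.toReal_ofReal (by simpa using ha)]
    simp
  · exact measureReal_le_one.trans h.le

variable {W : Type*} [Fintype W] (H : SimpleGraph W)

open Classical in
/-- The precision with which `u` can infer his arrival time from the number of friends observed. -/
noncomputable def timeError (u : W) : ℝ :=
  1 / Real.sqrt (max ((H.neighborFinset u).card - 1) 1 : ℕ)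

theorem timeError_pos (u : W) : 0 < timeError H u := by
  classical
  unfold timeError
  have : (0 : ℝ) < (max ((H.neighborFinset u).card - 1) 1 : ℕ) := by
    exact_mod_cast lt_of_lt_of_le one_pos (le_max_right _ _)
  positivity

variable {H}

-- For `s` between `8 * y + 4 * w` and `1 - 8 * y` the mean local score is at least `d * ε * s / 4`,
-- so Chebyshev gives `16 * w ^ 2 / s ≤ 4 * w`. The excluded times contribute at most `16 * y + 4 *
-- w`.
open Classical in
theorem measureReal_localScore_time_le {p : unitInterval} {σ : Profile W}
    (hσ : IsEquilibrium H p σ) (hs : IsStateSymmetric H p σ) (hp : 1 / 2 < (p : ℝ)) (θ : Bool)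
    (v : W) (r : ℕ) (hd : 0 < (H.neighborFinset v).card)
    (hdisj : (H.neighborFinset v : Set W).PairwiseDisjoint (avoidingBall H v r))
    (hb : ∀ u ∈ H.neighborFinset v, (configLaw W p).real {c | HasDecreasingChain H (time c) r u} ≤
      timeError H u / 20) {y w : ℝ}
    (hy : y = (∑ u ∈ H.neighborFinset v, timeError H u) /
      ((H.neighborFinset v).card * (2 * (p : ℝ) - 1)))
    (hw : w = 1 / ((2 * (p : ℝ) - 1) * Real.sqrt (H.neighborFinset v).card)) :
    (configLaw W p).real {c | localScore H σ r θ v (time c v) c ≤ 0} ≤ 16 * y + 8 * w := by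
  set d : ℝ := ((H.neighborFinset v).card : ℝ) with hdd
  set ε : ℝ := 2 * (p : ℝ) - 1 with hε
  have hd0 : 0 < d := Nat.cast_pos.2 hd
  have hε0 : 0 < ε := by linarith
  have hsum0 : 0 < ∑ u ∈ H.neighborFinset v, timeError H u :=
    Finset.sum_pos (fun u _ => timeError_pos H u) (Finset.card_pos.1 hd)
  have hy0 : 0 < y := by rw [hy]; positivity
  have hsd : 0 < Real.sqrt d := Real.sqrt_pos.2 hd0
  have hw0 : 0 < w := by rw [hw]; positivity
  have hw2 : w ^ 2 * (ε ^ 2 * d) = 1 := by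
    rw [hw, div_pow, mul_pow, Real.sq_sqrt hd0.le, one_pow, one_div,
      inv_mul_cancel₀ (by positivity)]
  rcases le_or_gt (16 * y) 1 with hy1 | hy1
  swap
  · exact measureReal_le_one.trans (by linarith)
  set g : unitInterval → ℝ := fun s => (if (s : ℝ) < 8 * y + 4 * w then (1 : ℝ) else 0) +
    (if 1 - 8 * y < (s : ℝ) then (1 : ℝ) else 0) + 4 * w with hg
  have hg1 : Measurable fun s : unitInterval => if (s : ℝ) < 8 * y + 4 * w then (1 : ℝ) else 0 :=
    Measurable.ite (measurableSet_lt (by fun_prop) measurable_const) measurable_const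
      measurable_const
  have hg2 : Measurable fun s : unitInterval => if 1 - 8 * y < (s : ℝ) then (1 : ℝ) else 0 :=
    Measurable.ite (measurableSet_lt measurable_const (by fun_prop)) measurable_const
      measurable_const
  have hgm : Measurable g := (hg1.add hg2).add_const _
  have hg0 : ∀ s, 4 * w ≤ g s := fun s => by
    simp only [hg]; split_ifs <;> linarith
  have hgC : ∀ s, |g s| ≤ 2 + 4 * w := fun s => by
    rw [abs_of_nonneg (by linarith [hg0 s])]
    simp only [hg]; split_ifs <;> linarith
  have hmain : ∀ s, (configLaw W p).real {c | localScore H σ r θ v s c ≤ 0} ≤ g s := by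
    intro s
    by_cases h1 : (s : ℝ) < 8 * y + 4 * w
    · refine measureReal_le_one.trans ?_
      simp only [hg, if_pos h1]
      split_ifs <;> linarith
    by_cases h2 : 1 - 8 * y < (s : ℝ)
    · refine measureReal_le_one.trans ?_
      simp only [hg, if_pos h2]
      split_ifs <;> linarith
    have h1' : 8 * y + 4 * w ≤ (s : ℝ) := not_lt.1 h1
    have h2' : (s : ℝ) ≤ 1 - 8 * y := not_lt.1 h2
    have hs0 : 0 < (s : ℝ) := by linarith
    have hs1 : (s : ℝ) < 1 := by linarith
    have h1s : 0 < 1 - (s : ℝ) := by linarith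
    -- By `hb` the chain term is at most a tenth of `timeError H u / (1 - s)`, whence `11 / 10`.
    have hterm : ∀ u ∈ H.neighborFinset v, ε * s - (Real.pi + 11 / 10 / (1 - s)) * timeError H u ≤
        ∫ c, score θ (localAction H σ r v θ c u) * (if time c u < s then 1 else 0)
          ∂configLaw W p := by
      intro u hu
      have hadj : H.Adj u v := by simpa [H.adj_comm] using hu
      refine le_trans ?_ (le_integral_localScore hσ hs hp.le θ hadj r hs0 hs1)
      have e1 : (Real.pi + 1 / (1 - (s : ℝ))) /
          Real.sqrt (max ((H.neighborFinset u).card - 1) 1 : ℕ) =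
          (Real.pi + 1 / (1 - s)) * timeError H u := by
        unfold timeError
        ring
      have e2 : 2 / (1 - (s : ℝ)) * (configLaw W p).real {c | HasDecreasingChain H (time c) r u} ≤
          2 / (1 - (s : ℝ)) * (timeError H u / 20) :=
        mul_le_mul_of_nonneg_left (hb u hu) (by positivity)
      rw [e1]
      have e3 : (Real.pi + 11 / 10 / (1 - (s : ℝ))) * timeError H u =
          (Real.pi + 1 / (1 - (s : ℝ))) * timeError H u +
            2 / (1 - (s : ℝ)) * (timeError H u / 20) := by
        ring
      linarith
    have hsum := Finset.sum_le_sum hterm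
    rw [Finset.sum_sub_distrib, Finset.sum_const, nsmul_eq_mul, ← Finset.mul_sum, ← hdd] at hsum
    have hq : ∑ u ∈ H.neighborFinset v, timeError H u = d * ε * y := by
      rw [hy]; field_simp
    rw [hq] at hsum
    -- For `s ≤ 1 / 2` this uses `8 * y ≤ s`; for larger `s` it uses `8 * y ≤ 1 - s` and `16 * y ≤
    -- 1`.
    have hloss : (Real.pi + 11 / 10 / (1 - (s : ℝ))) * y ≤ 3 / 4 * s := by
      have hpi : Real.pi * y ≤ 3.15 * y := mul_le_mul_of_nonneg_right Real.pi_lt_d2.le hy0.le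
      rw [add_mul]
      rcases le_or_gt (s : ℝ) (1 / 2) with h | h
      · have h3 : 11 / 10 / (1 - (s : ℝ)) ≤ 11 / 5 := by
          rw [div_le_iff₀ h1s]; linarith
        have h4 := mul_le_mul_of_nonneg_right h3 hy0.le
        linarith
      · have h3 : 11 / 10 / (1 - (s : ℝ)) * y ≤ 11 / 80 := by
          rw [div_mul_eq_mul_div, div_le_iff₀ h1s]
          linarith
        linarith
    have hm : d * ε * s / 4 ≤ ∑ u ∈ H.neighborFinset v, ∫ c, score θ (localAction H σ r v θ c u) *
        (if time c u < s then 1 else 0) ∂configLaw W p := by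
      refine le_trans ?_ hsum
      have := mul_le_mul_of_nonneg_left hloss (mul_pos hd0 hε0).le
      linarith
    have hm0 : 0 < d * ε * s / 4 := by linarith [mul_pos (mul_pos hd0 hε0) hs0]
    refine (measureReal_localScore_le H p σ r θ v s hdisj hm0 hm).trans (le_trans ?_ (hg0 s))
    rw [div_le_iff₀ (pow_pos hm0 2), ← hdd]
    have e4 : 4 * w * (d * ε * s / 4) ^ 2 = (w * (ε ^ 2 * d)) * (d * s) * s / 4 := by ring
    rw [e4]
    have h5 : 4 ≤ w * (ε ^ 2 * d) * s := by
      have h6 : 4 * w ≤ (s : ℝ) := by linarith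
      have h7 : w * (ε ^ 2 * d) * (4 * w) ≤ w * (ε ^ 2 * d) * s :=
        mul_le_mul_of_nonneg_left h6 (mul_pos hw0 (mul_pos (pow_pos hε0 2) hd0)).le
      have h8 : w * (ε ^ 2 * d) * (4 * w) = 4 * (w ^ 2 * (ε ^ 2 * d)) := by ring
      rw [h8, hw2] at h7
      linarith
    have h9 := mul_le_mul_of_nonneg_left h5 (mul_pos hd0 hs0).le
    linarith
  refine (measureReal_localScore_time H p σ r θ v hgm hgC hmain).trans ?_
  have i1 : Integrable (fun s : unitInterval => if (s : ℝ) < 8 * y + 4 * w then (1 : ℝ) else 0) :=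
    Integrable.of_bound hg1.aestronglyMeasurable 1 (Filter.Eventually.of_forall fun s => by
      split_ifs <;> simp)
  have i2 : Integrable (fun s : unitInterval => if 1 - 8 * y < (s : ℝ) then (1 : ℝ) else 0) :=
    Integrable.of_bound hg2.aestronglyMeasurable 1 (Filter.Eventually.of_forall fun s => by
      split_ifs <;> simp)
  have e : ∫ s, g s = (∫ s : unitInterval, if (s : ℝ) < 8 * y + 4 * w then (1 : ℝ) else 0) +
      (∫ s : unitInterval, if 1 - 8 * y < (s : ℝ) then (1 : ℝ) else 0) + 4 * w := by
    simp only [hg]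
    rw [integral_add (f := fun s : unitInterval => (if (s : ℝ) < 8 * y + 4 * w then (1 : ℝ) else 0) +
      (if 1 - 8 * y < (s : ℝ) then (1 : ℝ) else 0)) (i1.add i2) (integrable_const _),
      integral_add i1 i2]
    simp
  rw [e]
  have h1 := integral_indicator_lt_le (a := 8 * y + 4 * w) (by positivity)
  have h2 := integral_indicator_gt_le (a := 8 * y) (by positivity)
  linarith

open Classical in
/-- An agent with many friends, most of whom have many friends, errs with small probability. -/
theorem le_agentQuality {p : unitInterval} {σ : Profile W}
    (hσ : IsEquilibrium H p σ) (hs : IsStateSymmetric H p σ) (hp : 1 / 2 < (p : ℝ))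
    (v : W) (r : ℕ) (hd : 0 < (H.neighborFinset v).card)
    (hdisj : (H.neighborFinset v : Set W).PairwiseDisjoint (avoidingBall H v r))
    (hb : ∀ u ∈ H.neighborFinset v, (configLaw W p).real {c | HasDecreasingChain H (time c) r u} ≤
      timeError H u / 20) :
    1 - ((∑ u ∈ H.neighborFinset v,
        (configLaw W p).real {c | HasDecreasingChain H (time c) r u}) +
      (16 * ((∑ u ∈ H.neighborFinset v, timeError H u) /
        ((H.neighborFinset v).card * (2 * (p : ℝ) - 1))) +
      8 * (1 / ((2 * (p : ℝ) - 1) * Real.sqrt (H.neighborFinset v).card)))) ≤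
    agentQuality H p σ v :=
  hσ.one_sub_le_agentQuality v fun θ => (measureReal_observedScore_le H p σ r θ v).trans
    (add_le_add le_rfl (measureReal_localScore_time_le hσ hs hp θ v r hd hdisj hb rfl rfl))

end AgentBound

/-! ### Disjoint balls from large girth -/

section Girth

variable {W : Type*} {H : SimpleGraph W}

/-- In a graph without short cycles, the balls around the neighbours of `v` are disjoint once `v` is
removed. -/
theorem pairwiseDisjoint_avoidingBall {r : ℕ}
    (hcyc : ∀ (a : W) (c : H.Walk a a), c.IsCycle → 2 * r + 3 ≤ c.length) (v : W) :
    {u | H.Adj v u}.PairwiseDisjoint (avoidingBall H v r) := by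
  classical
  intro u hu u' hu' hne
  refine Set.disjoint_left.2 ?_
  rintro x ⟨q, hq, hvq⟩ ⟨q', hq', hvq'⟩
  set P : H.Walk v x := SimpleGraph.Walk.cons hu q.bypass with hP
  set P' : H.Walk v x := SimpleGraph.Walk.cons hu' q'.bypass with hP'
  have hPp : P.IsPath := (SimpleGraph.Walk.cons_isPath_iff _ _).2
    ⟨q.bypass_isPath, fun h => hvq (q.support_bypass_subset_support h)⟩
  have hPp' : P'.IsPath := (SimpleGraph.Walk.cons_isPath_iff _ _).2
    ⟨q'.bypass_isPath, fun h => hvq' (q'.support_bypass_subset_support h)⟩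
  -- The union of the two paths from `v` to `x` has at most `2 * r + 2` edges. If it is a forest,
  -- the paths coincide and so do their first steps; otherwise it contains a cycle that is too
  -- short.
  set K : SimpleGraph W := SimpleGraph.fromEdgeSet {e | e ∈ P.edges ++ P'.edges} with hK
  have hKH : ∀ e ∈ P.edges ++ P'.edges, e ∈ H.edgeSet := by
    intro e he
    rcases List.mem_append.1 he with h | h
    · exact P.edges_subset_edgeSet h
    · exact P'.edges_subset_edgeSet h
  have hKe : ∀ e ∈ P.edges ++ P'.edges, e ∈ K.edgeSet := by
    intro e he
    rw [hK, SimpleGraph.edgeSet_fromEdgeSet]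
    exact ⟨he, fun hd => H.not_isDiag_of_mem_edgeSet (hKH e he) hd⟩
  have hKe' : ∀ e ∈ K.edgeSet, e ∈ P.edges ++ P'.edges := by
    intro e he
    rw [hK, SimpleGraph.edgeSet_fromEdgeSet] at he
    exact he.1
  have hPK : ∀ e ∈ P.edges, e ∈ K.edgeSet := fun e he => hKe e (List.mem_append_left _ he)
  have hPK' : ∀ e ∈ P'.edges, e ∈ K.edgeSet := fun e he => hKe e (List.mem_append_right _ he)
  by_cases hac : K.IsAcyclic
  · have := (SimpleGraph.isAcyclic_iff_subsingleton_path.1 hac v x).elim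
      ⟨P.transfer K hPK, hPp.transfer hPK⟩ ⟨P'.transfer K hPK', hPp'.transfer hPK'⟩
    have h1 : P.support = P'.support := by
      rw [← SimpleGraph.Walk.support_transfer P hPK, ← SimpleGraph.Walk.support_transfer P' hPK']
      exact congrArg (fun q : K.Path v x => q.1.support) this
    rw [hP, hP', SimpleGraph.Walk.support_cons, SimpleGraph.Walk.support_cons, List.cons.injEq,
      ← SimpleGraph.Walk.cons_tail_support q.bypass, ← SimpleGraph.Walk.cons_tail_support q'.bypass,
      List.cons.injEq] at h1
    exact hne h1.2.1
  · simp only [SimpleGraph.IsAcyclic, not_forall, not_not] at hac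
    obtain ⟨a, c, hc⟩ := hac
    have hle : K ≤ H := by
      intro a b hab
      exact hKH s(a, b) (hKe' s(a, b) hab)
    have h1 := hcyc a _ (hc.mapLe hle)
    rw [SimpleGraph.Walk.length_mapLe] at h1
    have h2 : c.edges ⊆ P.edges ++ P'.edges := fun e he => hKe' e (c.edges_subset_edgeSet he)
    have h3 := (hc.1.1.edges_nodup.subperm h2).length_le
    rw [List.length_append, SimpleGraph.Walk.length_edges, SimpleGraph.Walk.length_edges,
      SimpleGraph.Walk.length_edges] at h3
    have h4 : P.length ≤ r + 1 := by
      rw [hP, SimpleGraph.Walk.length_cons]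
      have := q.length_bypass_le_length
      omega
    have h5 : P'.length ≤ r + 1 := by
      rw [hP', SimpleGraph.Walk.length_cons]
      have := q'.length_bypass_le_length
      omega
    omega

theorem girth_le_length_induce {V : Type*} (G : SimpleGraph V) (s : Set V) (a : s)
    (c : (G.induce s).Walk a a) (hc : c.IsCycle) : G.girth ≤ c.length := by
  have h := SimpleGraph.girth_le_length
    (hc.map (f := (SimpleGraph.Embedding.induce (G := G) s).toHom)
      (SimpleGraph.Embedding.induce (G := G) s).injective)
  rwa [SimpleGraph.Walk.length_map] at h

end Girth

/-! ### Chain probabilities in terms of `psi` -/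

section ChainBound

theorem psi_zero_right (d D : ℕ) : psi d 0 D = 2 * d := by
  simp [psi]

/-- For `0 < r < D` the base `e D / r` exceeds `1`, so `psi` is at least `2 * D`, its value at `r =
0`. -/
theorem le_of_psi_lt_one {D r : ℕ} (hD : 1 ≤ D) (h : psi D r D < 1) : D ≤ r := by
  by_contra hr
  push Not at hr
  have hD' : (1 : ℝ) ≤ D := by exact_mod_cast hD
  rcases Nat.eq_zero_or_pos r with h0 | h0
  · rw [h0, psi_zero_right] at h
    linarith
  · have hr0 : (0 : ℝ) < r := by exact_mod_cast h0
    have hr' : (r : ℝ) ≤ D := by exact_mod_cast hr.le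
    have h1 : 1 ≤ Real.exp 1 * (D : ℝ) / r := by
      rw [le_div_iff₀ hr0]
      have := Real.add_one_le_exp (1 : ℝ)
      nlinarith
    have h2 := one_le_pow₀ h1 (n := r)
    unfold psi at h
    nlinarith

/-- `r ^ r / r! ≤ e ^ r`, since the left side is one term of the exponential series at `r`. -/
theorem pow_div_factorial_le_psi {D r : ℕ} (hD : 1 ≤ D) (hr : 1 ≤ r) :
    (D : ℝ) ^ r / ((r + 1).factorial : ℝ) ≤ psi D r D / (2 * D * (r + 1)) := by
  have hD' : (0 : ℝ) < D := by exact_mod_cast hD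
  have hr0 : (0 : ℝ) < r := by exact_mod_cast hr
  have h1 := Real.pow_div_factorial_le_exp (r : ℝ) hr0.le r
  have h2 : (D : ℝ) ^ r / (r.factorial : ℝ) ≤ (Real.exp 1 * (D : ℝ) / r) ^ r := by
    rw [div_pow, mul_pow, ← Real.exp_nat_mul, mul_one, div_le_div_iff₀ (by positivity)
      (by positivity)]
    rw [div_le_iff₀ (by positivity)] at h1
    have := mul_le_mul_of_nonneg_left h1 (pow_nonneg hD'.le r)
    linarith
  rw [Nat.factorial_succ, psi]
  push_cast
  rw [show (D : ℝ) ^ r / (((r : ℝ) + 1) * (r.factorial : ℝ)) =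
    ((D : ℝ) ^ r / (r.factorial : ℝ)) / (r + 1) by field_simp,
    show 2 * (D : ℝ) * (Real.exp 1 * (D : ℝ) / r) ^ r / (2 * D * (r + 1)) =
      (Real.exp 1 * (D : ℝ) / r) ^ r / (r + 1) by field_simp]
  exact div_le_div_of_nonneg_right h2 (by positivity)

end ChainBound

/-! ### Second eigenvalue and inner degrees -/

section Spectral

variable {V : Type*} [Fintype V] [DecidableEq V]

/-- All but one of the entries of a finite family are at most the second largest. -/
theorem le_getD_sort_one_of_ne (f : V → ℝ) {i j : V} (hij : i ≠ j)
    (hj : ((Finset.univ.val.map f).sort (· ≥ ·)).getD 1 0 < f j) :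
    f i ≤ ((Finset.univ.val.map f).sort (· ≥ ·)).getD 1 0 := by
  by_contra hi
  push Not at hi
  set L := (Finset.univ.val.map f).sort (· ≥ ·) with hL
  have hLs : L.Pairwise (· ≥ ·) := Multiset.pairwise_sort _ _
  set m := L.getD 1 0 with hm
  have hcount : (Finset.univ.val.map f).countP (fun x => m < x) = L.countP (fun x => m < x) := by
    rw [← Multiset.sort_eq (Finset.univ.val.map f) (· ≥ ·), ← hL, Multiset.coe_countP]
  have h2 : 2 ≤ (Finset.univ.val.map f).countP (fun x => m < x) := by
    rw [Multiset.countP_map]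
    have : ({i, j} : Finset V) ⊆ Finset.univ.filter fun a => m < f a := by
      intro a ha
      simp only [Finset.mem_insert, Finset.mem_singleton] at ha
      rcases ha with rfl | rfl <;> simp [hi, hj]
    have := Finset.card_le_card this
    rw [Finset.card_pair hij] at this
    exact this
  -- Two entries exceed `m`, so the list has a second entry and the default `0` of `getD` is not
  -- used.
  have hlen : 2 ≤ L.length := by
    rw [hcount] at h2
    exact h2.trans List.countP_le_length
  match hLeq : L with
  | [] => simp at hlen
  | [x] => simp at hlen
  | x :: y :: l =>
    have hmy : m = y := by simp [hm]
    have h3 : (y :: l).countP (fun x => m < x) = 0 := by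
      rw [List.countP_eq_zero]
      intro z hz
      have : z ≤ y := by
        rcases List.mem_cons.1 hz with rfl | hz
        · exact le_rfl
        · exact (List.pairwise_cons.1 (List.pairwise_cons.1 hLs).2).1 z hz
      simp [hmy, this]
    rw [hcount, List.countP_cons, h3] at h2
    split_ifs at h2 <;> omega

/-- Compare both sides of the eigenvalue equation at a coordinate of maximal modulus. -/
theorem abs_eigenvalue_le {V : Type*} [Fintype V] (G : SimpleGraph V) [DecidableRel G.Adj] {D : ℕ}
    (hreg : G.IsRegularOfDegree D) {l : ℝ} {x : V → ℝ} (hx : x ≠ 0)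
    (h : (G.adjMatrix ℝ).mulVec x = l • x) : |l| ≤ D := by
  obtain ⟨w, hw⟩ := Function.ne_iff.1 hx
  obtain ⟨k, -, hk⟩ := Finset.exists_max_image Finset.univ (fun v => |x v|) ⟨w, Finset.mem_univ w⟩
  have hk0 : 0 < |x k| := lt_of_lt_of_le (abs_pos.2 hw) (hk w (Finset.mem_univ w))
  have h1 := congrFun h k
  rw [SimpleGraph.adjMatrix_mulVec_apply, Pi.smul_apply, smul_eq_mul] at h1
  have h2 : |l| * |x k| ≤ D * |x k| := by
    rw [← abs_mul, ← h1]
    refine (Finset.abs_sum_le_sum_abs _ _).trans ((Finset.sum_le_card_nsmul _ _ |x k|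
      fun u _ => hk u (Finset.mem_univ u)).trans ?_)
    rw [nsmul_eq_mul, SimpleGraph.card_neighborFinset_eq_degree, hreg k]
  exact le_of_mul_le_mul_right h2 hk0

variable (G : SimpleGraph V) [DecidableRel G.Adj] {D : ℕ}

/-- The adjacency matrix of a regular graph contracts vectors of mean zero by the second eigenvalue. -/
theorem sum_adjMatrix_mulVec_sq_le (hreg : G.IsRegularOfDegree D) (y : V → ℝ) (hy : ∑ v, y v = 0) :
    ∑ v, ((G.adjMatrix ℝ).mulVec y v) ^ 2 ≤ absSecondEigenvalue G ^ 2 * ∑ v, y v ^ 2 := by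
  set hA := G.isHermitian_adjMatrix ℝ with hhA
  set A := G.adjMatrix ℝ with hAdef
  set e : V → V → ℝ := fun j => (hA.eigenvectorBasis j).ofLp with he
  set l : V → ℝ := hA.eigenvalues with hl
  have heig : ∀ j, A.mulVec (e j) = l j • e j := fun j => hA.mulVec_eigenvectorBasis j
  have hsymm : ∀ x z : V → ℝ, x ⬝ᵥ A.mulVec z = A.mulVec x ⬝ᵥ z := by
    intro x z
    rw [Matrix.dotProduct_mulVec, ← Matrix.mulVec_transpose]
    congr 1
    rw [hAdef, SimpleGraph.transpose_adjMatrix]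
  have hparseval : ∀ x : V → ℝ, ∑ j, (e j ⬝ᵥ x) ^ 2 = ∑ v, x v ^ 2 := by
    intro x
    have h1 := hA.eigenvectorBasis.sum_sq_norm_inner_right (WithLp.toLp 2 x)
    rw [EuclideanSpace.real_norm_sq_eq] at h1
    rw [← h1]
    refine Finset.sum_congr rfl fun j _ => ?_
    rw [Real.norm_eq_abs, sq_abs, EuclideanSpace.inner_eq_star_dotProduct, dotProduct_comm]
    simp [he]
  have hexpand : ∀ (x : V → ℝ) (v : V), x v = ∑ j, (e j ⬝ᵥ x) * e j v := by
    intro x v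
    have h1 := hA.eigenvectorBasis.sum_repr' (WithLp.toLp 2 x)
    have h2 := congrArg (fun z : EuclideanSpace ℝ V => z.ofLp v) h1
    simp only [WithLp.ofLp_sum, WithLp.ofLp_smul, Finset.sum_apply, Pi.smul_apply,
      smul_eq_mul] at h2
    rw [← h2]
    refine Finset.sum_congr rfl fun j _ => ?_
    rw [EuclideanSpace.inner_eq_star_dotProduct, dotProduct_comm]
    simp [he]
  have hcoord : ∀ j, e j ⬝ᵥ A.mulVec y = l j * (e j ⬝ᵥ y) := by
    intro j
    rw [hsymm, heig, smul_dotProduct, smul_eq_mul]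
  have hone : A.mulVec (fun _ => 1) = (D : ℝ) • fun _ => (1 : ℝ) := by
    funext v
    rw [SimpleGraph.adjMatrix_mulVec_apply]
    simp [hreg v]
  have hne : ∀ j, e j ≠ 0 := by
    intro j h0
    have h1 := hA.eigenvectorBasis.orthonormal.1 j
    have h2 : hA.eigenvectorBasis j = 0 := by
      ext v
      exact congrFun h0 v
    rw [h2, norm_zero] at h1
    exact zero_ne_one h1
  have hterm : ∀ j, (l j) ^ 2 * (e j ⬝ᵥ y) ^ 2 ≤ absSecondEigenvalue G ^ 2 * (e j ⬝ᵥ y) ^ 2 := by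
    intro j
    rcases le_or_gt |l j| (absSecondEigenvalue G) with h | h
    · refine mul_le_mul_of_nonneg_right ?_ (sq_nonneg _)
      rw [← sq_abs (l j)]
      exact pow_le_pow_left₀ (abs_nonneg _) h 2
    -- Every other eigenvalue has modulus below `|l j| ≤ D`, so its eigenvector is orthogonal to the
    -- constants. Hence the constants are multiples of `e j`, and `y` has no component along it.
    -- Connectedness is not needed.
    · have horth : ∀ i, i ≠ j → e i ⬝ᵥ (fun _ => (1 : ℝ)) = 0 := by
        intro i hij
        have h1 : |l i| ≤ absSecondEigenvalue G := le_getD_sort_one_of_ne (fun v => |l v|) hij h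
        have h2 := abs_eigenvalue_le G hreg (hne j) (heig j)
        have h3 : e i ⬝ᵥ A.mulVec (fun _ => (1 : ℝ)) = l i * (e i ⬝ᵥ fun _ => (1 : ℝ)) := by
          rw [hsymm, heig, smul_dotProduct, smul_eq_mul]
        rw [hone, dotProduct_smul, smul_eq_mul] at h3
        have h4 : l i ≠ D := by
          intro h5
          rw [h5, Nat.abs_cast] at h1
          linarith
        have h5 : ((D : ℝ) - l i) * (e i ⬝ᵥ fun _ => (1 : ℝ)) = 0 := by linarith
        exact (mul_eq_zero.1 h5).resolve_left (sub_ne_zero.2 h4.symm)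
      have h6 : ∀ v : V, (1 : ℝ) = (e j ⬝ᵥ fun _ => (1 : ℝ)) * e j v := by
        intro v
        refine (hexpand (fun _ => 1) v).trans (Finset.sum_eq_single_of_mem j (Finset.mem_univ j)
          fun i _ hij => ?_)
        rw [horth i hij, zero_mul]
      have h7 : (e j ⬝ᵥ fun _ => (1 : ℝ)) * (e j ⬝ᵥ y) = 0 := by
        have : ∑ v, y v = ∑ v, (e j ⬝ᵥ fun _ => (1 : ℝ)) * (e j v * y v) :=
          Finset.sum_congr rfl fun v _ => by rw [← mul_assoc, ← h6, one_mul]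
        rw [hy, ← Finset.mul_sum] at this
        exact this.symm
      have h8 : e j ⬝ᵥ y = 0 := by
        refine (mul_eq_zero.1 h7).resolve_left fun h9 => ?_
        have := h6 j
        rw [h9, zero_mul] at this
        exact one_ne_zero this
      rw [h8]
      simp
  rw [← hparseval (A.mulVec y), ← hparseval y, Finset.mul_sum]
  refine Finset.sum_le_sum fun j _ => ?_
  rw [hcoord, mul_pow]
  exact hterm j

/-- The number of neighbours inside a set `S` is close to its mean, for most vertices of `S`. -/
theorem sum_card_neighbors_sub_sq_le [Nonempty V] (hreg : G.IsRegularOfDegree D) (S : Finset V) {β : ℝ}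
    (hβ : (S.card : ℝ) = β * Fintype.card V) :
    ∑ v ∈ S, (((G.neighborFinset v ∩ S).card : ℝ) - β * D) ^ 2 ≤
      absSecondEigenvalue G ^ 2 * (S.card * (1 - β)) := by
  -- The centred indicator of `S`: its image under the adjacency matrix is the deviation of the
  -- inner degree from `β * D`.
  set y : V → ℝ := fun v => (if v ∈ S then 1 else 0) - β with hy
  have hcard : ∑ v : V, (if v ∈ S then (1 : ℝ) else 0) = S.card := by simp
  have hy0 : ∑ v, y v = 0 := by
    simp only [hy, Finset.sum_sub_distrib, hcard, Finset.sum_const, Finset.card_univ, nsmul_eq_mul]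
    linarith
  have hy2 : ∑ v, y v ^ 2 = S.card * (1 - β) := by
    have e : ∀ v, y v ^ 2 = (1 - 2 * β) * (if v ∈ S then 1 else 0) + β ^ 2 := by
      intro v
      simp only [hy]
      split_ifs <;> ring
    simp_rw [e]
    rw [Finset.sum_add_distrib, ← Finset.mul_sum, hcard]
    simp only [Finset.sum_const, Finset.card_univ, nsmul_eq_mul]
    linear_combination β * (-hβ)
  have hAy : ∀ v, (G.adjMatrix ℝ).mulVec y v =
      ((G.neighborFinset v ∩ S).card : ℝ) - β * D := by
    intro v
    rw [SimpleGraph.adjMatrix_mulVec_apply]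
    simp only [hy, Finset.sum_sub_distrib, Finset.sum_const, SimpleGraph.card_neighborFinset_eq_degree,
      hreg v, nsmul_eq_mul, Finset.sum_ite_mem]
    simp
    ring
  rw [← hy2]
  refine le_trans ?_ (sum_adjMatrix_mulVec_sq_le G hreg y hy0)
  simp_rw [hAy]
  exact Finset.sum_le_sum_of_subset_of_nonneg (Finset.subset_univ S) fun v _ _ => sq_nonneg _

end Spectral

/-! ### Summing the errors over all agents -/

section Assembly

variable {W : Type*} [Fintype W] (H : SimpleGraph W)

open Classical in
theorem timeError_le {k : ℝ} (hk : 1 < k) {u : W} (hu : k ≤ (H.neighborFinset u).card) :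
    timeError H u ≤ 1 / Real.sqrt (k - 1) := by
  unfold timeError
  refine one_div_le_one_div_of_le (Real.sqrt_pos.2 (by linarith)) (Real.sqrt_le_sqrt ?_)
  have h1 : (1 : ℝ) < (H.neighborFinset u).card := hk.trans_le hu
  have h2 : 1 ≤ (H.neighborFinset u).card := by exact_mod_cast h1.le
  have h3 : (((H.neighborFinset u).card - 1 : ℕ) : ℝ) ≤
      ((max ((H.neighborFinset u).card - 1) 1 : ℕ) : ℝ) := by exact_mod_cast le_max_left _ _
  rw [Nat.cast_sub h2, Nat.cast_one] at h3
  linarith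

-- Converts a uniform chain bound in terms of `D` into the one relative to `timeError` that
-- `le_agentQuality` requires.
open Classical in
theorem one_div_sqrt_le_timeError {D : ℕ} (hD : 1 ≤ D) {u : W}
    (hu : (H.neighborFinset u).card ≤ D) : 1 / Real.sqrt D ≤ timeError H u := by
  unfold timeError
  refine one_div_le_one_div_of_le (Real.sqrt_pos.2 ?_) (Real.sqrt_le_sqrt ?_)
  · exact_mod_cast lt_of_lt_of_le one_pos (le_max_right _ _)
  · exact_mod_cast max_le (by omega) hD

-- The constant comes from `d ^ 2 ≤ 9 / 4 * (d * (d - 1))` for `d ≥ 2`.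
open Classical in
theorem card_mul_timeError_le {k : ℝ} (hk : 1 ≤ k) {u : W} (hu : (H.neighborFinset u).card ≤ k) :
    (H.neighborFinset u).card * timeError H u ≤ 3 / 2 * Real.sqrt k := by
  unfold timeError
  set d := (H.neighborFinset u).card
  have hm : (1 : ℝ) ≤ (max (d - 1) 1 : ℕ) := by exact_mod_cast le_max_right _ _
  rw [mul_one_div, div_le_iff₀ (Real.sqrt_pos.2 (by linarith)), mul_assoc,
    ← Real.sqrt_mul (by linarith)]
  have h1 : 2 * (d : ℝ) / 3 ≤ Real.sqrt (k * (max (d - 1) 1 : ℕ)) := by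
    refine Real.le_sqrt_of_sq_le ?_
    rcases Nat.lt_or_ge d 2 with h | h
    · have h2 : (d : ℝ) ≤ 1 := by exact_mod_cast Nat.lt_succ_iff.1 h
      have h3 : (0 : ℝ) ≤ d := Nat.cast_nonneg _
      nlinarith
    · have h2 : (2 : ℝ) ≤ d := by exact_mod_cast h
      have h3 : ((max (d - 1) 1 : ℕ) : ℝ) = d - 1 := by
        rw [max_eq_left (by omega), Nat.cast_sub (by omega), Nat.cast_one]
      rw [h3]
      nlinarith
  linarith

open Classical in
/-- The contribution of friends with few friends is bounded by counting edges from their side. -/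
theorem sum_timeError_div_le {k : ℝ} (hk : 1 < k) :
    ∑ v ∈ Finset.univ.filter (fun v => k ≤ (H.neighborFinset v).card),
        (∑ u ∈ H.neighborFinset v, timeError H u) / (H.neighborFinset v).card ≤
      (Fintype.card W + 3 / 2 * (Finset.univ.filter fun v =>
        ((H.neighborFinset v).card : ℝ) < k).card) / Real.sqrt (k - 1) := by
  set good := Finset.univ.filter (fun v => k ≤ (H.neighborFinset v).card) with hgood
  set low := Finset.univ.filter (fun v => ((H.neighborFinset v).card : ℝ) < k) with hlow
  set τ := 1 / Real.sqrt (k - 1) with hτ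
  have hk0 : 0 < k := by linarith
  have hτ0 : 0 ≤ τ := by positivity
  set f : W → ℝ := fun u => if u ∈ low then timeError H u else 0 with hf
  have hf0 : ∀ u, 0 ≤ f u := by
    intro u
    simp only [hf]
    split_ifs
    · exact (timeError_pos H u).le
    · exact le_rfl
  have hte : ∀ u, timeError H u ≤ τ + f u := by
    intro u
    by_cases hu : u ∈ low
    · simp only [hf, if_pos hu]
      linarith
    · simp only [hf, if_neg hu, add_zero]
      refine timeError_le H hk (not_lt.1 fun h => hu ?_)
      exact Finset.mem_filter.2 ⟨Finset.mem_univ u, h⟩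
  have h1 : ∀ v ∈ good, (∑ u ∈ H.neighborFinset v, timeError H u) / (H.neighborFinset v).card ≤
      τ + 1 / k * ∑ u ∈ H.neighborFinset v, f u := by
    intro v hv
    have hkv : k ≤ (H.neighborFinset v).card := (Finset.mem_filter.1 hv).2
    have hd0 : (0 : ℝ) < (H.neighborFinset v).card := hk0.trans_le hkv
    rw [div_le_iff₀ hd0]
    refine (Finset.sum_le_sum fun u _ => hte u).trans ?_
    rw [Finset.sum_add_distrib, Finset.sum_const, nsmul_eq_mul, add_mul, mul_comm _ τ]
    have h2 : 1 ≤ 1 / k * ((H.neighborFinset v).card : ℝ) := by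
      rw [one_div_mul_eq_div, le_div_iff₀ hk0, one_mul]
      exact hkv
    have h3 : 0 ≤ ∑ u ∈ H.neighborFinset v, f u := Finset.sum_nonneg fun u _ => hf0 u
    have h4 := mul_le_mul_of_nonneg_right h2 h3
    linarith
  -- After exchanging the sums, each low-degree `u` is counted at most once per friend, and
  -- `card_mul_timeError_le` bounds degree times `timeError`.
  have h5 : ∑ v ∈ good, ∑ u ∈ H.neighborFinset v, f u ≤ low.card * (3 / 2 * Real.sqrt k) := by
    have e1 : ∀ v, ∑ u ∈ H.neighborFinset v, f u = ∑ u, if H.Adj v u then f u else 0 := by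
      intro v
      have : H.neighborFinset v = Finset.univ.filter fun u => H.Adj v u := by
        ext u
        simp
      rw [this, Finset.sum_filter]
    have e2 : ∀ u, ∑ v, (if H.Adj v u then f u else 0) =
        if u ∈ low then (H.neighborFinset u).card * timeError H u else 0 := by
      intro u
      rw [← Finset.sum_filter, Finset.sum_const, nsmul_eq_mul]
      have : (Finset.univ.filter fun v => H.Adj v u) = H.neighborFinset u := by
        ext v
        simp [H.adj_comm]
      rw [this]
      simp only [hf]
      split_ifs <;> simp
    calc ∑ v ∈ good, ∑ u ∈ H.neighborFinset v, f u
        ≤ ∑ v, ∑ u ∈ H.neighborFinset v, f u :=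
          Finset.sum_le_sum_of_subset_of_nonneg (Finset.subset_univ _) fun v _ _ =>
            Finset.sum_nonneg fun u _ => hf0 u
      _ = ∑ u, if u ∈ low then (H.neighborFinset u).card * timeError H u else 0 := by
          simp_rw [e1]
          rw [Finset.sum_comm]
          exact Finset.sum_congr rfl fun u _ => e2 u
      _ = ∑ u ∈ low, (H.neighborFinset u).card * timeError H u := by
          rw [Finset.sum_ite_mem, Finset.univ_inter]
      _ ≤ ∑ u ∈ low, 3 / 2 * Real.sqrt k :=
          Finset.sum_le_sum fun u hu =>
            card_mul_timeError_le H hk.le (Finset.mem_filter.1 hu).2.le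
      _ = low.card * (3 / 2 * Real.sqrt k) := by rw [Finset.sum_const, nsmul_eq_mul]
  refine (Finset.sum_le_sum h1).trans ?_
  rw [Finset.sum_add_distrib, ← Finset.mul_sum, Finset.sum_const, nsmul_eq_mul, add_div]
  refine add_le_add ?_ ?_
  · rw [div_eq_mul_one_div]
    exact mul_le_mul_of_nonneg_right (by exact_mod_cast Finset.card_le_univ good) hτ0
  · have h6 : Real.sqrt k / k ≤ τ := by
      rw [Real.sqrt_div_self']
      exact one_div_le_one_div_of_le (Real.sqrt_pos.2 (by linarith)) (Real.sqrt_le_sqrt (by linarith))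
    have h7 := mul_le_mul_of_nonneg_left h5 (one_div_nonneg.2 hk0.le)
    have h8 := mul_le_mul_of_nonneg_left h6 (by positivity : (0 : ℝ) ≤ 3 / 2 * low.card)
    rw [mul_comm (3 / 2 * (low.card : ℝ)) τ, hτ, one_div_mul_eq_div] at h8
    refine h7.trans (le_trans (le_of_eq ?_) h8)
    ring

theorem agentQuality_nonneg (p : unitInterval) (σ : Profile W) (v : W) :
    0 ≤ agentQuality H p σ v := measureReal_nonneg

open Classical in
/-- In a network with few short cycles and few agents of small degree, the expected number of agents
who err is small. -/
theorem card_sub_sum_agentQuality_le {p : unitInterval} {σ : Profile W}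
    (hσ : IsEquilibrium H p σ) (hs : IsStateSymmetric H p σ) (hp : 1 / 2 < (p : ℝ)) {r D : ℕ}
    (hD : 1 ≤ D) (hcard : ∀ v, (H.neighborFinset v).card ≤ D)
    (hcyc : ∀ (a : W) (c : H.Walk a a), c.IsCycle → 2 * r + 3 ≤ c.length)
    {b : ℝ} (hb : ∀ v, (configLaw W p).real {c | HasDecreasingChain H (time c) r v} ≤ b)
    (hbD : b ≤ 1 / (20 * Real.sqrt D)) {k : ℝ} (hk : 1 < k) :
    Fintype.card W - ∑ v, agentQuality H p σ v ≤
      (Finset.univ.filter fun v => ((H.neighborFinset v).card : ℝ) < k).card *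
          (1 + 24 / ((2 * (p : ℝ) - 1) * Real.sqrt (k - 1))) +
        Fintype.card W * (D * b + 24 / ((2 * (p : ℝ) - 1) * Real.sqrt (k - 1))) := by
  set good := Finset.univ.filter (fun v => k ≤ (H.neighborFinset v).card) with hgood
  set low := Finset.univ.filter (fun v => ((H.neighborFinset v).card : ℝ) < k) with hlow
  set ε := 2 * (p : ℝ) - 1 with hε
  have hε0 : 0 < ε := by linarith
  have hk0 : 0 < k := by linarith
  have hs0 : 0 < Real.sqrt (k - 1) := Real.sqrt_pos.2 (by linarith)
  have hgl : low = Finset.univ.filter fun v => ¬ k ≤ ((H.neighborFinset v).card : ℝ) :=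
    Finset.filter_congr fun v _ => not_le.symm
  have hsplit : (Fintype.card W : ℝ) = good.card + low.card := by
    rw [hgl, ← Nat.cast_add, Finset.card_filter_add_card_filter_not, Finset.card_univ]
  have hD0 : (1 : ℝ) ≤ D := by exact_mod_cast hD
  have hquality : ∀ v ∈ good, 1 - agentQuality H p σ v ≤ (D * b + 8 / (ε * Real.sqrt (k - 1))) +
      16 / ε * ((∑ u ∈ H.neighborFinset v, timeError H u) / (H.neighborFinset v).card) := by
    intro v hv
    have hkv : k ≤ (H.neighborFinset v).card := (Finset.mem_filter.1 hv).2
    have hd0 : (0 : ℝ) < (H.neighborFinset v).card := hk0.trans_le hkv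
    have hdisj : (H.neighborFinset v : Set W).PairwiseDisjoint (avoidingBall H v r) := by
      intro u hu u' hu' hne
      exact pairwiseDisjoint_avoidingBall hcyc v (by simpa using hu) (by simpa using hu') hne
    have h1 := le_agentQuality hσ hs hp v r (by exact_mod_cast hd0) hdisj fun u _ => by
      refine (hb u).trans (hbD.trans ?_)
      have := one_div_sqrt_le_timeError H hD (hcard u)
      calc 1 / (20 * Real.sqrt D) = 1 / Real.sqrt D / 20 := by
            rw [div_div, mul_comm]
        _ ≤ timeError H u / 20 := by linarith
    have hb0 : 0 ≤ b := measureReal_nonneg.trans (hb v)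
    have h2 : ∑ u ∈ H.neighborFinset v,
        (configLaw W p).real {c | HasDecreasingChain H (time c) r u} ≤ D * b := by
      refine (Finset.sum_le_sum fun u _ => hb u).trans ?_
      rw [Finset.sum_const, nsmul_eq_mul]
      exact mul_le_mul_of_nonneg_right (by exact_mod_cast hcard v) hb0
    have h3 : 1 / (ε * Real.sqrt (H.neighborFinset v).card) ≤ 1 / (ε * Real.sqrt (k - 1)) :=
      one_div_le_one_div_of_le (mul_pos hε0 hs0)
        (mul_le_mul_of_nonneg_left (Real.sqrt_le_sqrt (by linarith)) hε0.le)
    have e1 : 8 / (ε * Real.sqrt (k - 1)) = 8 * (1 / (ε * Real.sqrt (k - 1))) := by ring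
    have e2 : 16 / ε * ((∑ u ∈ H.neighborFinset v, timeError H u) / (H.neighborFinset v).card) =
        16 * ((∑ u ∈ H.neighborFinset v, timeError H u) / ((H.neighborFinset v).card * ε)) := by
      field_simp
    rw [e1, e2]
    linarith
  have hsum : (Fintype.card W : ℝ) - ∑ v, agentQuality H p σ v =
      ∑ v ∈ good, (1 - agentQuality H p σ v) + ∑ v ∈ low, (1 - agentQuality H p σ v) := by
    rw [hgl, Finset.sum_filter_add_sum_filter_not, Finset.sum_sub_distrib]
    simp
  have hlowsum : ∑ v ∈ low, (1 - agentQuality H p σ v) ≤ low.card := by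
    refine (Finset.sum_le_sum fun v _ => sub_le_self 1 (agentQuality_nonneg H p σ v)).trans ?_
    simp
  rw [hsum]
  refine (add_le_add (Finset.sum_le_sum hquality) hlowsum).trans ?_
  rw [Finset.sum_add_distrib, Finset.sum_const, nsmul_eq_mul, ← Finset.mul_sum]
  have h4 := mul_le_mul_of_nonneg_left (sum_timeError_div_le H hk) (by positivity : 0 ≤ 16 / ε)
  -- The two constants `24` arise as `16 * 3 / 2` for the low-degree agents and as `16 + 8` for
  -- everybody.
  have e3 : 16 / ε * ((Fintype.card W + 3 / 2 * (low.card : ℝ)) / Real.sqrt (k - 1)) =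
      Fintype.card W * (16 / (ε * Real.sqrt (k - 1))) +
        low.card * (24 / (ε * Real.sqrt (k - 1))) := by
    field_simp
    ring
  have e4 : 24 / (ε * Real.sqrt (k - 1)) =
      16 / (ε * Real.sqrt (k - 1)) + 8 / (ε * Real.sqrt (k - 1)) := by
    rw [← add_div]
    norm_num
  rw [e3] at h4
  have h5 : (good.card : ℝ) * (D * b + 8 / (ε * Real.sqrt (k - 1))) ≤
      Fintype.card W * (D * b + 8 / (ε * Real.sqrt (k - 1))) := by
    rcases Finset.eq_empty_or_nonempty good with h | ⟨v, -⟩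
    · rw [hsplit, h, Finset.card_empty, Nat.cast_zero, zero_mul]
      rcases isEmpty_or_nonempty W with hW | ⟨⟨v⟩⟩
      · simp [Finset.eq_empty_of_isEmpty low]
      · have hb0 : 0 ≤ b := measureReal_nonneg.trans (hb v)
        positivity
    · have hb0 : 0 ≤ b := measureReal_nonneg.trans (hb v)
      refine mul_le_mul_of_nonneg_right ?_ (by positivity)
      exact_mod_cast Finset.card_le_univ good
  have e5 : (Fintype.card W : ℝ) * (D * b + 24 / (ε * Real.sqrt (k - 1))) =
      Fintype.card W * (D * b + 8 / (ε * Real.sqrt (k - 1))) +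
        Fintype.card W * (16 / (ε * Real.sqrt (k - 1))) := by
    rw [e4]
    ring
  have e6 : (low.card : ℝ) * (1 + 24 / (ε * Real.sqrt (k - 1))) =
      low.card + low.card * (24 / (ε * Real.sqrt (k - 1))) := by ring
  rw [e5, e6]
  linarith

end Assembly

/-! ### Counting low degrees and final arithmetic -/

section Parameters

theorem psi_nonneg (d r D : ℕ) : 0 ≤ psi d r D := by
  unfold psi
  positivity

/-- A set in which the mean number of inner neighbours is `β * D` has few vertices with less than half of
that number. -/
theorem card_filter_lt_le {V : Type*} (S : Finset V) (d : V → ℕ) {α β D Q : ℝ} (hα : 0 < α)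
    (hαβ : α ≤ β) (hD : 0 < D) (hQ : 0 ≤ Q)
    (h : ∑ v ∈ S, ((d v : ℝ) - β * D) ^ 2 ≤ Q * (S.card * (1 - β))) :
    ((S.filter fun v => (d v : ℝ) < α * D / 2).card : ℝ) ≤
      4 * ((1 - α) * Q / (α ^ 2 * D ^ 2)) * S.card := by
  set low := S.filter fun v => (d v : ℝ) < α * D / 2
  -- A low vertex lies at least `α * D / 2` below the mean `β * D`, because `α ≤ β`.
  have h1 : low.card * (α * D / 2) ^ 2 ≤ ∑ v ∈ S, ((d v : ℝ) - β * D) ^ 2 := by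
    rw [← nsmul_eq_mul]
    refine (Finset.card_nsmul_le_sum low _ _ fun v hv => ?_).trans
      (Finset.sum_le_sum_of_subset_of_nonneg (Finset.filter_subset _ _) fun v _ _ => sq_nonneg _)
    have h2 : (d v : ℝ) < α * D / 2 := (Finset.mem_filter.1 hv).2
    have h3 : α * D ≤ β * D := mul_le_mul_of_nonneg_right hαβ hD.le
    rw [← neg_sq ((d v : ℝ) - β * D)]
    refine pow_le_pow_left₀ (by positivity) ?_ 2
    linarith
  have h4 : Q * (S.card * (1 - β)) ≤ Q * (S.card * (1 - α)) := by
    gcongr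
  have e : 4 * ((1 - α) * Q / (α ^ 2 * D ^ 2)) * S.card =
      Q * (S.card * (1 - α)) / (α * D / 2) ^ 2 := by
    field_simp
    ring
  rw [e, le_div_iff₀ (by positivity)]
  linarith

/-- The arithmetic that turns the bound on the number of erring agents into the final bound. -/
theorem one_sub_le_of_error_le {α D ε ψ Q L x y : ℝ} (hα : 0 < α) (hα₁ : α ≤ 1) (hD : 1 < D)
    (hε₁ : ε ≤ 1) (hψ : 0 ≤ ψ) (hψε : 0 < ε - ψ) (hQ : 0 ≤ Q) (hL : 0 ≤ L)
    (hx : x ≤ 4 * ((1 - α) * Q / (α ^ 2 * D ^ 2))) (hx0 : 0 ≤ x)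
    (hy : 1 < α * D / 2 → y ≤ ψ)
    (h : 36 < Real.sqrt (α * D) → 1 < α * D / 2 →
      1 - L ≤ x * (1 + 24 / (ε * Real.sqrt (α * D / 2 - 1))) +
        (y + 24 / (ε * Real.sqrt (α * D / 2 - 1)))) :
    1 - (2 / Real.sqrt α + (1 - α) * Q / (α ^ 3 * (D * Real.sqrt D))) *
      (ψ + 18 / (Real.sqrt (D - 1) * (ε - ψ))) ≤ L := by
  have ha : 0 < Real.sqrt α := Real.sqrt_pos.2 hα
  have ha1 : Real.sqrt α ≤ 1 := Real.sqrt_le_one.2 hα₁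
  have hq : 0 < Real.sqrt (D - 1) := Real.sqrt_pos.2 (by linarith)
  have hD0 : 0 < D := by linarith
  have hε0 : 0 < ε := by linarith
  have hsD : 0 < Real.sqrt D := Real.sqrt_pos.2 hD0
  have hqD : Real.sqrt (D - 1) ≤ Real.sqrt D := Real.sqrt_le_sqrt (by linarith)
  set B := (1 - α) * Q / (α ^ 3 * (D * Real.sqrt D)) with hB
  set R := 18 / (Real.sqrt (D - 1) * (ε - ψ)) with hR
  have h1α : 0 ≤ 1 - α := by linarith
  have hB0 : 0 ≤ B := by positivity
  have hR0 : 0 < R := by positivity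
  have hA2 : 2 ≤ 2 / Real.sqrt α := by
    rw [le_div_iff₀ ha]
    linarith
  have hAR : 2 / Real.sqrt α * R = 36 / (Real.sqrt α * Real.sqrt (D - 1) * (ε - ψ)) := by
    rw [hR]
    field_simp
    norm_num
  have hexp : (2 / Real.sqrt α + B) * (ψ + R) =
      2 / Real.sqrt α * ψ + 2 / Real.sqrt α * R + B * ψ + B * R := by ring
  have hAψ : ψ ≤ 2 / Real.sqrt α * ψ := by nlinarith
  have hBψ : 0 ≤ B * ψ := mul_nonneg hB0 hψ
  have hBR : 0 ≤ B * R := mul_nonneg hB0 hR0.le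
  rw [hexp]
  -- If this product reaches `1`, the claimed lower bound is at most `0`. Otherwise `36 < M ≤ √(α
  -- D)`, so the degree is large enough for `h`.
  rcases le_or_gt 1 (2 / Real.sqrt α * R) with h1 | h1
  · linarith
  set M := Real.sqrt α * Real.sqrt (D - 1) * (ε - ψ) with hM
  have hM0 : 0 < M := by positivity
  have hM36 : 36 < M := by
    rw [hAR, div_lt_one hM0] at h1
    exact h1
  set z := Real.sqrt (α * D) with hz
  have hzz : z = Real.sqrt α * Real.sqrt D := Real.sqrt_mul hα.le D
  have hMz : M ≤ ε * z := by
    rw [hzz, hM, mul_comm ε]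
    gcongr
    linarith
  have hεz : ε * z ≤ z := by
    have : 0 ≤ z := Real.sqrt_nonneg _
    nlinarith
  have hz36 : 36 < z := by linarith
  have hz2 : z ^ 2 = α * D := Real.sq_sqrt (by positivity)
  have hk : 1296 < α * D := by
    rw [← hz2]
    nlinarith
  set Y := 24 / (ε * Real.sqrt (α * D / 2 - 1)) with hY
  have hYR : Y ≤ 2 / Real.sqrt α * R := by
    -- The factor `2 / 3` turns `24` into `36`, which is `2 * 18` as in `hAR`; in particular `Y <
    -- 1`.
    have h2 : 2 / 3 * z ≤ Real.sqrt (α * D / 2 - 1) := by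
      refine Real.le_sqrt_of_sq_le ?_
      rw [mul_pow, hz2]
      linarith
    calc Y ≤ 24 / (ε * (2 / 3 * z)) := by
          rw [hY]
          gcongr
      _ = 36 / (ε * z) := by
          field_simp
          norm_num
      _ ≤ 36 / M := by gcongr
      _ = 2 / Real.sqrt α * R := hAR.symm
  -- Low-degree agents are weighted by `1 + Y ≤ 2`. Against the required factor `8`, the product `B
  -- * R` provides at least `18`.
  have hxB : 2 * x ≤ B * R := by
    have h2 : 8 * ((1 - α) * Q / (α ^ 2 * D ^ 2)) ≤ B * R := by
      have e : B * R = (1 - α) * Q / (α ^ 2 * D ^ 2) *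
          (18 * Real.sqrt D / (α * (Real.sqrt (D - 1) * (ε - ψ)))) := by
        have : D = Real.sqrt D * Real.sqrt D := (Real.mul_self_sqrt hD0.le).symm
        rw [hB, hR]
        field_simp
        rw [sq, this.symm]
      rw [e, mul_comm (8 : ℝ)]
      refine mul_le_mul_of_nonneg_left ?_ (by positivity)
      rw [le_div_iff₀ (by positivity)]
      have h3 : α * (Real.sqrt (D - 1) * (ε - ψ)) ≤ 1 * (Real.sqrt D * 1) := by
        gcongr
        linarith
      linarith
    linarith
  have h2 := h hz36 (by linarith)
  have h3 := hy (by linarith)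
  have h4 : x * (1 + Y) ≤ x * 2 := mul_le_mul_of_nonneg_left (by linarith) hx0
  linarith

end Parameters

/-! ### Specialization to the induced network -/

section InducedNetwork

theorem psi_div_le_one_div_sqrt {D r : ℕ} (hD : 100 ≤ D) (hDr : D ≤ r) (hψ : psi D r D < 1) :
    psi D r D / (2 * D * (r + 1)) ≤ 1 / (20 * Real.sqrt D) := by
  have hD' : (100 : ℝ) ≤ D := by exact_mod_cast hD
  have hr' : (D : ℝ) ≤ r := by exact_mod_cast hDr
  have h1 : Real.sqrt D ≤ D := (Real.sqrt_le_left (by linarith)).2 (by nlinarith)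
  have h2 : 0 < Real.sqrt D := Real.sqrt_pos.2 (by linarith)
  refine (div_le_div_of_nonneg_right hψ.le (by positivity)).trans
    (one_div_le_one_div_of_le (by positivity) ?_)
  nlinarith

open Classical in
/-- The bound on the learning quality of a network without short cycles, in terms of the number of
agents of small degree. -/
theorem le_networkQuality {W : Type*} [Fintype W] [Nonempty W] (H : SimpleGraph W)
    {p : unitInterval} {σ : Profile W}
    (hσ : IsEquilibrium H p σ) (hs : IsStateSymmetric H p σ) (hp : 1 / 2 < (p : ℝ)) {r D : ℕ}
    (hD : 2 ≤ D) (hcard : ∀ v, (H.neighborFinset v).card ≤ D)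
    (hcyc : ∀ (a : W) (c : H.Walk a a), c.IsCycle → 2 * r + 3 ≤ c.length)
    (hψ : 0 < 2 * (p : ℝ) - 1 - psi D r D) {α Q : ℝ} (hα₀ : 0 < α) (hα₁ : α ≤ 1) (hQ : 0 ≤ Q)
    (hlow : ((Finset.univ.filter fun v => ((H.neighborFinset v).card : ℝ) < α * D / 2).card : ℝ) ≤
      4 * ((1 - α) * Q / (α ^ 2 * D ^ 2)) * Fintype.card W) :
    1 - (2 / Real.sqrt α + (1 - α) * Q / (α ^ 3 * (D : ℝ) ^ (3 / 2 : ℝ))) * delta (p : ℝ) D r D ≤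
      networkQuality H p σ := by
  have hp1 : (p : ℝ) ≤ 1 := p.2.2
  have hψ0 : 0 ≤ psi D r D := psi_nonneg D r D
  have hψ1 : psi D r D < 1 := by linarith
  have hDr : D ≤ r := le_of_psi_lt_one (by omega) hψ1
  have hD0 : (2 : ℝ) ≤ D := by exact_mod_cast hD
  have hn : (0 : ℝ) < Fintype.card W := by exact_mod_cast Fintype.card_pos
  have hb : ∀ v, (configLaw W p).real {c | HasDecreasingChain H (time c) r v} ≤
      psi D r D / (2 * D * (r + 1)) := fun v =>
    (measureReal_hasDecreasingChain_le H p hcard r v).trans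
      (pow_div_factorial_le_psi (by omega) (by omega))
  have hpow : (D : ℝ) ^ (3 / 2 : ℝ) = D * Real.sqrt D := by
    rw [show (3 / 2 : ℝ) = 1 + 1 / 2 by norm_num, Real.rpow_add (by linarith), Real.rpow_one,
      Real.sqrt_eq_rpow]
  have hquality : networkQuality H p σ = (∑ v, agentQuality H p σ v) / Fintype.card W := by
    rw [networkQuality, one_div_mul_eq_div]
  rw [hpow, delta]
  refine one_sub_le_of_error_le
    (x := (Finset.univ.filter fun v => ((H.neighborFinset v).card : ℝ) < α * D / 2).card /
      Fintype.card W)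
    (y := D * (psi D r D / (2 * D * (r + 1)))) hα₀ hα₁ (by linarith) (by linarith)
    hψ0 hψ hQ ?_ ?_ (by positivity) ?_ ?_
  · rw [hquality]
    exact div_nonneg (Finset.sum_nonneg fun v _ => agentQuality_nonneg H p σ v) hn.le
  · exact (div_le_iff₀ hn).2 hlow
  · intro _
    have hr0 : (0 : ℝ) ≤ r := Nat.cast_nonneg r
    have e : D * (psi D r D / (2 * D * (r + 1))) = psi D r D / (2 * (r + 1)) := by
      field_simp
    rw [e]
    exact div_le_self hψ0 (by linarith)
  · intro h1 h2
    -- Since `α ≤ 1`, `√(α D) > 36` gives far more than the degree needed by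
    -- `psi_div_le_one_div_sqrt`.
    have hD100 : 100 ≤ D := by
      have h3 : Real.sqrt (α * D) ^ 2 = α * D := Real.sq_sqrt (by positivity)
      have h4 : (100 : ℝ) ≤ D := by nlinarith
      exact_mod_cast h4
    have h3 := card_sub_sum_agentQuality_le H hσ hs hp (by omega) hcard hcyc hb
      (psi_div_le_one_div_sqrt hD100 hDr hψ1) h2
    rw [hquality]
    have h5 := div_le_div_of_nonneg_right h3 hn.le
    rw [sub_div, div_self hn.ne', add_div, mul_div_right_comm, mul_div_cancel_left₀ _ hn.ne'] at h5
    exact h5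

theorem card_neighborFinset_induce {V : Type*} [Fintype V] [DecidableEq V] (G : SimpleGraph V)
    [DecidableRel G.Adj] (S : Finset V) (v : (S : Set V))
    [Fintype ((G.induce (S : Set V)).neighborSet v)] :
    ((G.induce (S : Set V)).neighborFinset v).card = (G.neighborFinset v ∩ S).card := by
  rw [← Finset.card_map (Function.Embedding.subtype (· ∈ (S : Set V)))]
  congr 1
  ext u
  simp only [Finset.mem_map, SimpleGraph.mem_neighborFinset, SimpleGraph.comap_adj,
    Function.Embedding.subtype_apply, Finset.mem_inter]
  constructor
  · rintro ⟨w, hw, rfl⟩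
    exact ⟨hw, w.2⟩
  · rintro ⟨h1, h2⟩
    exact ⟨⟨u, h2⟩, h1, rfl⟩

end InducedNetwork

end SocialLearning

theorem lemma3 {V : Type*} [Fintype V] [DecidableEq V] [Nonempty V]
    (G : SimpleGraph V) [DecidableRel G.Adj]
    (D : ℕ) (hD : 2 ≤ D) (hreg : G.IsRegularOfDegree D)
    (p : unitInterval) (hp : 1 / 2 < (p : ℝ))
    (hpsi : 0 < 2 * (p : ℝ) - 1 - SocialLearning.psi D ((G.girth - 3) / 2) D)
    (α : ℝ) (hα₀ : 0 < α) (hα₁ : α ≤ 1)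
    (V' : Finset V) (hV' : V'.card = ⌈α * (Fintype.card V : ℝ)⌉₊)
    (σ : SocialLearning.Profile (V' : Set V))
    (hσ : SocialLearning.IsEquilibrium (G.induce (V' : Set V)) p σ)
    (hsymm : SocialLearning.IsStateSymmetric (G.induce (V' : Set V)) p σ) :
    1 - (2 / Real.sqrt α +
          (1 - α) * SocialLearning.absSecondEigenvalue G ^ 2 / (α ^ 3 * (D : ℝ) ^ (3 / 2 : ℝ))) *
        SocialLearning.delta (p : ℝ) D ((G.girth - 3) / 2) D
      ≤ SocialLearning.networkQuality (G.induce (V' : Set V)) p σ := by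
  have hN : (0 : ℝ) < Fintype.card V := by exact_mod_cast Fintype.card_pos
  have hD0 : (2 : ℝ) ≤ D := by exact_mod_cast hD
  have hαN : α * (Fintype.card V : ℝ) ≤ V'.card := by
    rw [hV']
    exact Nat.le_ceil _
  have hn : (0 : ℝ) < V'.card := (mul_pos hα₀ hN).trans_le hαN
  have hcardW : Fintype.card (V' : Set V) = V'.card := Fintype.card_coe V'
  have : Nonempty (V' : Set V) := by
    rw [← Fintype.card_pos_iff, hcardW]
    exact_mod_cast hn
  have hψ1 : SocialLearning.psi D ((G.girth - 3) / 2) D < 1 := by linarith [p.2.2]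
  -- As `r ≥ D ≥ 2`, truncated subtraction does no harm and the girth is at least `2 * r + 3`.
  -- Forests, whose `girth` is `0`, are excluded by `hpsi`.
  have hDr := SocialLearning.le_of_psi_lt_one (by omega) hψ1
  -- `β` is the exact density of `V'`; because of the ceiling it may exceed `α`.
  have hreg' := SocialLearning.sum_card_neighbors_sub_sq_le G hreg V'
    (β := V'.card / Fintype.card V) (by field_simp)
  have hlow := SocialLearning.card_filter_lt_le V' (fun v => (G.neighborFinset v ∩ V').card) hα₀
    ((le_div_iff₀ hN).2 hαN) (by linarith) (sq_nonneg _) hreg'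
  refine SocialLearning.le_networkQuality _ hσ hsymm hp hD (fun v => ?_) (fun a c hc => ?_) hpsi
    hα₀ hα₁ (sq_nonneg _) ?_
  · rw [SocialLearning.card_neighborFinset_induce]
    refine (Finset.card_le_card Finset.inter_subset_left).trans ?_
    rw [SimpleGraph.card_neighborFinset_eq_degree, hreg]
  · have := SocialLearning.girth_le_length_induce G _ a c hc
    omega
  · rw [hcardW]
    refine le_trans ?_ hlow
    refine Nat.cast_le.2 (Finset.card_le_card_of_injOn Subtype.val (fun v hv => ?_)
      Subtype.val_injective.injOn)
    have h1 := (Finset.mem_filter.1 (Finset.mem_coe.1 hv)).2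
    rw [SocialLearning.card_neighborFinset_induce] at h1
    exact Finset.mem_coe.2 (Finset.mem_filter.2 ⟨v.2, h1⟩)
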